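/- Let $\mathbb F$ be a field, let $\alpha,\beta\ge 1$ be coprime integers, and let $R=\mathbb F[X,Y]$ be $\mathbb Z$-graded with $\deg X=\alpha$ and $\deg Y=\beta$. Let $M=\bigoplus_{n\in\mathbb Z}M_n$ be a finitely generated graded $R$-module with Hilbert series $\sum_{n\in\mathbb Z}h_nt^n$, $h_n=\dim_{\mathbb F}M_n$. Definitions. The depth of a finitely generated graded $R$-module $N$ is the maximal length of an $N$-regular sequence in $\mathfrak m=(X,Y)$, with the convention that the depth of the zero module is $\infty$. The Hilbert depth of $M$ is the maximum of $\operatorname{depth}(N)$ over all finitely generated graded $R$-modules $N$ with the same Hilbert series as $M$. Let $L=\mathbb N_0\setminus(\mathbb N_0\alpha+\mathbb N_0\beta)$ be the set of gaps of the numerical semigroup $\langle\alpha,\beta\rangle$. An $(\alpha,\beta)$-fundamental couple $[I,J]$ consists of two integer sequences $I=(i_k)_{k=0}^m$ and $J=(j_k)_{k=0}^m$, for some $m\ge 0$, such that - $i_0=0$; - $i_1,\dots,i_m,\,j_1,\dots,j_{m-1}\in L$ and $j_0,j_m\le\alpha\beta$; - $i_k\equiv j_k \pmod\alpha$ and $i_k<j_k$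 for $0\le k\le m$; $j_k\equiv i_{k+1}\pmod\beta$ and $j_k>i_{k+1}$ for $0\le k\le m-1$; $j_m\equiv i_0\pmod\beta$ and $j_m\ge i_0$; - $|i_k-i_\ell|\in L$ for $1\le k<\ell\le m$. Theorem. $M$ has positive Hilbert depth if and only if $$(\star)\qquad \sum_{k=0}^m h_{i_k+n}\;\le\;\sum_{k=0}^m h_{j_k+n}\qquad\text{for all } n\in\mathbb Z \text{ and all } (\alpha,\beta)\text{-fundamental couples } [I,J]=[(i_k)_{k=0}^m,(j_k)_{k=0}^m].$$ -/

import Mathlib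

universe u v

namespace HilbertDepth

/-- The degrees of the two variables, as integers: `deg X₀ = α`, `deg X₁ = β`. -/
def weight (α β : ℕ) : Fin 2 → ℤ := ![(α : ℤ), (β : ℤ)]

/-- `ℳ` is a `ℤ`-grading which makes `M` a graded module over `F[X₀, X₁]`, where `F[X₀, X₁]` carries
the grading with `deg X₀ = α` and `deg X₁ = β`. -/
structure IsGradedModule {F : Type u} [Field F] (α β : ℕ)
    {M : Type v} [AddCommGroup M] [Module F M] [Module (MvPolynomial (Fin 2) F) M]
    (ℳ : ℤ → Submodule F M) : Prop where
  isInternal : DirectSum.IsInternal ℳ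
  gradedSMul :
    SetLike.GradedSMul (MvPolynomial.weightedHomogeneousSubmodule F (weight α β)) ℳ

/-- The Hilbert function `n ↦ dim_F M_n`, i.e. the coefficient function of the Hilbert series
`∑ₙ (dim_F M_n) tⁿ`. (The components of a finitely generated graded module over a positively
graded polynomial ring are finite-dimensional.) -/
noncomputable def hilbertFunction {F : Type u} [Field F] {M : Type v} [AddCommGroup M] [Module F M]
    (ℳ : ℤ → Submodule F M) (n : ℤ) : ℕ :=
  Module.finrank F (ℳ n)

open Classical in
/-- The grade of the ideal `I` on `M`: the maximal length of an `M`-regular sequence in `I`, with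
the usual convention that it is `∞` if `I M = M`. -/
noncomputable def idealGrade {R : Type u} [CommRing R] (I : Ideal R) (M : Type v) [AddCommGroup M]
    [Module R M] : ℕ∞ :=
  if I • (⊤ : Submodule R M) = ⊤ then ⊤
  else sSup {d : ℕ∞ | ∃ rs : List R, (∀ r ∈ rs, r ∈ I) ∧
    RingTheory.Sequence.IsRegular M rs ∧ d = (rs.length : ℕ∞)}

/-- The depth of a module over `F[X₀, X₁]`: the grade of the ideal `(X₀, X₁)` on it. -/
noncomputable def depth (F : Type u) [Field F] (M : Type v) [AddCommGroup M]
    [Module (MvPolynomial (Fin 2) F) M] : ℕ∞ :=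
  idealGrade (Ideal.span {(MvPolynomial.X 0 : MvPolynomial (Fin 2) F), MvPolynomial.X 1}) M

/-- The Hilbert depth of a graded module `M` over `F[X₀, X₁]` (`deg X₀ = α`, `deg X₁ = β`): the
maximum of the depths of all finitely generated graded modules `N` with the Hilbert function of
`M`. Every finitely generated `F[X₀, X₁]`-module is isomorphic to a quotient of a finite free
module, hence to one in the universe of `F`, so that it is enough to let `N` range over this
universe. -/
noncomputable def hilbertDepth {F : Type u} [Field F] (α β : ℕ)
    {M : Type v} [AddCommGroup M] [Module F M] (ℳ : ℤ → Submodule F M) : ℕ∞ :=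
  sSup {d : ℕ∞ | ∃ (N : Type u) (_ : AddCommGroup N) (_ : Module F N)
    (_ : Module (MvPolynomial (Fin 2) F) N) (_ : IsScalarTower F (MvPolynomial (Fin 2) F) N)
    (𝒩 : ℤ → Submodule F N),
      Module.Finite (MvPolynomial (Fin 2) F) N ∧ IsGradedModule α β 𝒩 ∧
      hilbertFunction 𝒩 = hilbertFunction ℳ ∧ depth F N = d}

/-- The gaps of the numerical semigroup `⟨α, β⟩`: the nonnegative integers which do not belong to
the additive submonoid of `ℕ` generated by `α` and `β`. -/
def gaps (α β : ℕ) : Set ℤ :=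
  {e : ℤ | ∃ p : ℕ, p ∉ AddSubmonoid.closure ({α, β} : Set ℕ) ∧ (p : ℤ) = e}

/-- `[I, J]` with `I = (i 0, …, i m)` and `J = (j 0, …, j m)` is an `(α, β)`-fundamental couple. -/
structure IsFundamentalCouple (α β : ℕ) {m : ℕ} (i j : Fin (m + 1) → ℤ) : Prop where
  i_zero : i 0 = 0
  i_mem_gaps : ∀ k : Fin (m + 1), k ≠ 0 → i k ∈ gaps α β
  j_mem_gaps : ∀ k : Fin (m + 1), k ≠ 0 → k ≠ Fin.last m → j k ∈ gaps α β
  j_zero_le : j 0 ≤ (α : ℤ) * β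
  j_last_le : j (Fin.last m) ≤ (α : ℤ) * β
  modEq_left : ∀ k : Fin (m + 1), i k ≡ j k [ZMOD α]
  lt_left : ∀ k : Fin (m + 1), i k < j k
  modEq_right : ∀ k : Fin m, j k.castSucc ≡ i k.succ [ZMOD β]
  lt_right : ∀ k : Fin m, i k.succ < j k.castSucc
  modEq_last : j (Fin.last m) ≡ i 0 [ZMOD β]
  le_last : i 0 ≤ j (Fin.last m)
  abs_sub_mem_gaps : ∀ k l : Fin (m + 1), k ≠ 0 → k < l → |i k - i l| ∈ gaps α β

/-- The condition `(⋆)` on the coefficients of a series `∑ₙ hₙ tⁿ`. -/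
def StarCondition (α β : ℕ) (h : ℤ → ℕ) : Prop :=
  ∀ (n : ℤ) (m : ℕ) (i j : Fin (m + 1) → ℤ), IsFundamentalCouple α β i j →
    ∑ k, h (i k + n) ≤ ∑ k, h (j k + n)

end HilbertDepth

/-!
Let `x = X₀`, `y = X₁`, and `h n = dim Mₙ`.

**Positive depth implies `(⋆)`.** If `N` has positive depth, then no nonzero element of `N` is
killed both by a power of `x` and by a power of `y`. For a fundamental couple `[I, J]` and a shift
`n`, multiplication with powers of `x` gives maps from the degree `i k + n` to the degree `j k + n`,
and multiplication with powers of `y` maps from the degree `i (k + 1) + n` to the degree `j k + n`,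
cyclically in `k`. Put a formal parameter `t` in front of the last `y`-map. The difference of the
`x`-maps and the `y`-maps is then a pencil `T₁ + t T₂` from `⨁ₖ N_{i k + n}` to `⨁ₖ N_{j k + n}`.
The coefficients of a polynomial vector in its kernel form a finite chain, in which an `x`-power
multiple of each entry is a `y`-power multiple of the next one. So every entry is killed by a power
of `x` (going along the chain from one end) and by a power of `y` (going from the other end), and
the pencil is injective. Hence the dimension of the source is at most that of the target
(`finrank_le_of_pencil`). The parameter makes the argument work over finite fields.

**`(⋆)` implies positive depth.** It suffices to find a finite direct sum of shifted copies of
`F[x]`, `F[y]` and `F[x, y]` with the Hilbert function `h`, because `x + y` is a nonzerodivisor on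
such a module. First `h` is written as `u + v` with `u n ≤ u (n + α)` and `v n ≤ v (n + β)`. This is
a system of difference constraints, solvable if no closed walk on `ℤ` with steps `+α` and `-β` has
negative cost, where a step from `n` to `n + α` costs `h (n + α) - h n` and the other steps are
free. Every closed walk decomposes into closed walks with exactly `α + β` steps (`exists_window`),
and the valleys and peaks of such a walk, seen from its lowest point, are a fundamental couple
(`walkCost_nonneg_of_min`), for which `(⋆)` says that the cost is nonnegative.

The increments `a n = u n - u (n - α)` and `b n = v n - v (n - β)` then describe `h` as the Hilbert
function of a possibly infinite sum of copies of `F[x]` and `F[y]`. To make it finite, one uses that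
`(1 - t^α)(1 - t^β) ∑ h n t^n` is a Laurent polynomial
(`IsGradedModule.koszulDiff_eventually_zero`). If its degree is less than `N`, then `a` may be
replaced from `N` on by its `β`-periodic continuation, and `b` by its `α`-periodic continuation,
without changing the product; a periodic tail is the contribution of free generators
(`isRealizable_of_add`).
-/

namespace HilbertDepth

open MvPolynomial

/-! ### Components of a graded module -/

section GradedModule

variable {F : Type u} [Field F] {α β : ℕ} {M : Type v} [AddCommGroup M] [Module F M]
  [Module (MvPolynomial (Fin 2) F) M] {ℳ : ℤ → Submodule F M}

theorem IsGradedModule.X_smul_mem (h : IsGradedModule α β ℳ) (t : Fin 2) {n : ℤ} {v : M}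
    (hv : v ∈ ℳ n) : (X t : MvPolynomial (Fin 2) F) • v ∈ ℳ (n + weight α β t) := by
  have := h.gradedSMul.smul_mem
    ((mem_weightedHomogeneousSubmodule F (weight α β) _ _).2
      (isWeightedHomogeneous_X F (weight α β) t)) hv
  rwa [vadd_eq_add, add_comm] at this

theorem IsGradedModule.X_pow_smul_mem (h : IsGradedModule α β ℳ) (t : Fin 2) {n : ℤ} {v : M}
    (hv : v ∈ ℳ n) (k : ℕ) :
    (X t ^ k : MvPolynomial (Fin 2) F) • v ∈ ℳ (n + k * weight α β t) := by
  induction k with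
  | zero => simpa using hv
  | succ k ih =>
    rw [pow_succ', mul_smul]
    convert h.X_smul_mem t ih using 2
    push_cast; ring

open Classical in
/-- The projection of a graded module onto its component of degree `n`, as an endomorphism. -/
noncomputable def IsGradedModule.proj (h : IsGradedModule α β ℳ) (n : ℤ) : M →ₗ[F] M :=
  let _ := h.isInternal.chooseDecomposition
  (ℳ n).subtype ∘ₗ DirectSum.component F ℤ (fun i => ℳ i) n ∘ₗ
    (DirectSum.decomposeLinearEquiv ℳ).toLinearMap

theorem IsGradedModule.proj_mem (h : IsGradedModule α β ℳ) (n : ℤ) (v : M) : h.proj n v ∈ ℳ n := by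
  simp [IsGradedModule.proj]

theorem IsGradedModule.proj_of_mem (h : IsGradedModule α β ℳ) {n : ℤ} {v : M} (hv : v ∈ ℳ n) :
    h.proj n v = v := by
  classical
  let _ := h.isInternal.chooseDecomposition
  exact DirectSum.decompose_of_mem_same ℳ hv

theorem IsGradedModule.proj_of_mem_ne (h : IsGradedModule α β ℳ) {m n : ℤ} {v : M} (hv : v ∈ ℳ m)
    (hmn : m ≠ n) : h.proj n v = 0 := by
  classical
  let _ := h.isInternal.chooseDecomposition
  exact DirectSum.decompose_of_mem_ne ℳ hv hmn

theorem IsGradedModule.homogeneous_induction (h : IsGradedModule α β ℳ) {p : M → Prop} (zero : p 0)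
    (homogeneous : ∀ n, ∀ v ∈ ℳ n, p v) (add : ∀ v w, p v → p w → p (v + w)) (v : M) : p v := by
  classical
  let _ := h.isInternal.chooseDecomposition
  exact DirectSum.Decomposition.inductionOn ℳ zero (fun {i} m => homogeneous i m m.2) add v

theorem IsGradedModule.proj_eventually_zero (h : IsGradedModule α β ℳ) (v : M) :
    ∃ B : ℤ, ∀ n, B ≤ |n| → h.proj n v = 0 := by
  induction v using h.homogeneous_induction with
  | zero => exact ⟨0, fun n _ => map_zero _⟩
  | homogeneous m v hv =>
    exact ⟨|m| + 1, fun n hn => h.proj_of_mem_ne hv (by rintro rfl; omega)⟩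
  | add v w hv hw =>
    obtain ⟨B, hB⟩ := hv
    obtain ⟨C, hC⟩ := hw
    exact ⟨max B C, fun n hn => by
      rw [map_add, hB n (le_trans (le_max_left _ _) hn), hC n (le_trans (le_max_right _ _) hn),
        add_zero]⟩

theorem IsGradedModule.eq_zero_of_proj (h : IsGradedModule α β ℳ) {v : M}
    (hv : ∀ n, h.proj n v = 0) : v = 0 := by
  classical
  let _ := h.isInternal.chooseDecomposition
  apply (DirectSum.decompose ℳ).injective
  ext n
  rw [DirectSum.decompose_zero]
  exact hv n

theorem IsGradedModule.proj_X_smul (h : IsGradedModule α β ℳ) (t : Fin 2) (n : ℤ) (v : M) :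
    h.proj n ((X t : MvPolynomial (Fin 2) F) • v) =
      (X t : MvPolynomial (Fin 2) F) • h.proj (n - weight α β t) v := by
  induction v using h.homogeneous_induction with
  | zero => simp
  | homogeneous m v hv =>
    by_cases hmn : m = n - weight α β t
    · subst hmn
      rw [h.proj_of_mem hv, h.proj_of_mem]
      simpa using h.X_smul_mem t hv
    · rw [h.proj_of_mem_ne hv hmn, smul_zero]
      exact h.proj_of_mem_ne (h.X_smul_mem t hv) (by omega)
  | add v w hv hw => rw [smul_add, map_add, hv, hw, map_add, smul_add]

/-- A finite set of vectors only meets finitely many degrees. -/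
theorem IsGradedModule.exists_bound_of_finite (h : IsGradedModule α β ℳ) {S : Set M}
    (hS : S.Finite) :
    ∃ B : ℤ, ∀ n, B ≤ |n| → ∀ v ∈ Submodule.span F S, h.proj n v = 0 := by
  choose B hB using h.proj_eventually_zero
  obtain ⟨C, hC⟩ := (hS.image B).bddAbove
  refine ⟨C, fun n hn v hv => ?_⟩
  suffices Submodule.span F S ≤ LinearMap.ker (h.proj n) from this hv
  rw [Submodule.span_le]
  intro s hs
  exact hB s n ((hC ⟨s, hs, rfl⟩).trans hn)

end GradedModule

/-! ### Generators -/

section Generators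

variable {F : Type u} [Field F] {P : Type v} [AddCommGroup P] [Module F P]
  [Module (MvPolynomial (Fin 2) F) P] [IsScalarTower F (MvPolynomial (Fin 2) F) P]

theorem exists_eq_C_add_X_mul (r : MvPolynomial (Fin 2) F) :
    ∃ (c : F) (r' r'' : MvPolynomial (Fin 2) F), r = C c + X 0 * r' + X 1 * r'' := by
  induction r using MvPolynomial.induction_on with
  | C a => exact ⟨a, 0, 0, by ring⟩
  | add p q hp hq =>
    obtain ⟨c, p', p'', hp⟩ := hp
    obtain ⟨d, q', q'', hq⟩ := hq
    exact ⟨c + d, p' + q', p'' + q'', by rw [hp, hq, C_add]; ring⟩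
  | mul_X p t _ =>
    fin_cases t
    · exact ⟨0, p, 0, by simp [mul_comm]⟩
    · exact ⟨0, 0, p, by simp [mul_comm]⟩

/-- A submodule `Z` generated by `S` satisfies `Z = F S + X₀ Z + X₁ Z`. -/
theorem exists_eq_add_X_smul_of_span {Z : Submodule (MvPolynomial (Fin 2) F) P} {S : Set P}
    (hS : Submodule.span _ S = Z) {z : P} (hz : z ∈ Z) :
    ∃ y ∈ Submodule.span F S, ∃ z' ∈ Z, ∃ z'' ∈ Z,
      z = y + (X 0 : MvPolynomial (Fin 2) F) • z' + (X 1 : MvPolynomial (Fin 2) F) • z'' := by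
  subst hS
  induction hz using Submodule.span_induction with
  | mem x hx => exact ⟨x, Submodule.subset_span hx, 0, zero_mem _, 0, zero_mem _, by simp⟩
  | zero => exact ⟨0, zero_mem _, 0, zero_mem _, 0, zero_mem _, by simp⟩
  | add x y _ _ hx hy =>
    obtain ⟨a, ha, b, hb, c, hc, rfl⟩ := hx
    obtain ⟨a', ha', b', hb', c', hc', rfl⟩ := hy
    exact ⟨a + a', add_mem ha ha', b + b', add_mem hb hb', c + c', add_mem hc hc', by
      simp only [smul_add]; abel⟩
  | smul r x hx ih =>
    obtain ⟨a, ha, b, hb, c, hc, h⟩ := ih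
    obtain ⟨d, r', r'', hr⟩ := exists_eq_C_add_X_mul r
    refine ⟨d • a, Submodule.smul_mem _ _ ha, C d • b + r' • x,
      add_mem (Submodule.smul_mem _ _ hb) (Submodule.smul_mem _ _ hx),
      C d • c + r'' • x, add_mem (Submodule.smul_mem _ _ hc) (Submodule.smul_mem _ _ hx), ?_⟩
    have hd : d • a = (C d : MvPolynomial (Fin 2) F) • a := by
      rw [← algebraMap_eq, algebraMap_smul]
    calc r • x = (C d : MvPolynomial (Fin 2) F) • x + (X 0 * r') • x + (X 1 * r'') • x := by
          rw [hr, add_smul, add_smul]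
      _ = (C d : MvPolynomial (Fin 2) F) • (a + (X 0 : MvPolynomial (Fin 2) F) • b
            + (X 1 : MvPolynomial (Fin 2) F) • c) + (X 0 * r') • x + (X 1 * r'') • x := by rw [← h]
      _ = _ := by
        rw [hd]
        simp only [smul_add, mul_smul, smul_comm (C d : MvPolynomial (Fin 2) F) (X _)]
        abel

/-- Up to a finite-dimensional space, every submodule `Z` of a finitely generated module equals
`X₀ Z + X₁ Z`. -/
theorem exists_finite_span_add_X_smul [Module.Finite (MvPolynomial (Fin 2) F) P]
    (Z : Submodule (MvPolynomial (Fin 2) F) P) :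
    ∃ S : Set P, S.Finite ∧ ∀ z ∈ Z, ∃ y ∈ Submodule.span F S, ∃ z' ∈ Z, ∃ z'' ∈ Z,
      z = y + (X 0 : MvPolynomial (Fin 2) F) • z' + (X 1 : MvPolynomial (Fin 2) F) • z'' := by
  obtain ⟨S, hS⟩ := IsNoetherian.noetherian Z
  exact ⟨S, S.finite_toSet, fun z hz => exists_eq_add_X_smul_of_span hS hz⟩

end Generators

/-! ### Finitely generated graded modules and the Koszul complex -/

section FiniteGradedModule

variable {F : Type u} [Field F] {α β : ℕ} {M : Type v} [AddCommGroup M] [Module F M]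
  [Module (MvPolynomial (Fin 2) F) M] [IsScalarTower F (MvPolynomial (Fin 2) F) M]
  {ℳ : ℤ → Submodule F M}

theorem IsGradedModule.component_bddBelow [Module.Finite (MvPolynomial (Fin 2) F) M]
    (h : IsGradedModule α β ℳ) : ∃ B : ℤ, ∀ n ≤ B, ℳ n = ⊥ := by
  obtain ⟨S, hS⟩ := Module.Finite.fg_top (R := MvPolynomial (Fin 2) F) (M := M)
  obtain ⟨B, hB⟩ := h.exists_bound_of_finite S.finite_toSet
  have hw : ∀ t, 0 ≤ weight α β t := by intro t; fin_cases t <;> simp [weight]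
  -- the elements without components in low degrees are a submodule containing the generators
  have key : ∀ (r : MvPolynomial (Fin 2) F) (v : M), (∀ n ≤ -|B|, h.proj n v = 0) →
      ∀ n ≤ -|B|, h.proj n (r • v) = 0 := by
    intro r
    induction r using MvPolynomial.induction_on with
    | C a =>
      intro v hv n hn
      rw [← algebraMap_eq, algebraMap_smul, map_smul, hv n hn, smul_zero]
    | add p q hp hq =>
      intro v hv n hn
      rw [add_smul, map_add, hp v hv n hn, hq v hv n hn, add_zero]
    | mul_X p t hp =>
      intro v hv n hn
      rw [mul_smul]
      refine hp _ (fun k hk => ?_) n hn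
      rw [h.proj_X_smul, hv _ (by have := hw t; omega), smul_zero]
  refine ⟨-|B|, fun n hn => (Submodule.eq_bot_iff _).2 fun v hv => ?_⟩
  have hall : ∀ n ≤ -|B|, h.proj n v = 0 := by
    clear hv
    have hv : v ∈ Submodule.span (MvPolynomial (Fin 2) F) (S : Set M) := by rw [hS]; trivial
    induction hv using Submodule.span_induction with
    | mem x hx =>
      intro n hn
      refine hB n ?_ x (Submodule.subset_span hx)
      have := neg_le_abs n
      have := le_abs_self B
      omega
    | zero => intro n _; exact map_zero _
    | add x y _ _ hx hy => intro n hn; rw [map_add, hx n hn, hy n hn, add_zero]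
    | smul r x _ hx => exact key r x hx
  rw [← h.proj_of_mem hv, hall n hn]

/-- Graded Nakayama lemma. -/
theorem IsGradedModule.eq_zero_of_smul_top [Module.Finite (MvPolynomial (Fin 2) F) M]
    (h : IsGradedModule α β ℳ) (hα : 0 < α) (hβ : 0 < β)
    (htop : Ideal.span {(X 0 : MvPolynomial (Fin 2) F), X 1} •
      (⊤ : Submodule (MvPolynomial (Fin 2) F) M) = ⊤) (v : M) :
    v = 0 := by
  obtain ⟨B, hB⟩ := h.component_bddBelow
  have hdec : ∀ v : M, ∃ x y : M,
      v = (X 0 : MvPolynomial (Fin 2) F) • x + (X 1 : MvPolynomial (Fin 2) F) • y := by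
    intro v
    have hv : v ∈ Ideal.span {(X 0 : MvPolynomial (Fin 2) F), X 1} •
        (⊤ : Submodule (MvPolynomial (Fin 2) F) M) := by
      rw [htop]; trivial
    rw [Ideal.span_insert, Submodule.sup_smul, Submodule.ideal_span_singleton_smul,
      Submodule.ideal_span_singleton_smul] at hv
    obtain ⟨_, ⟨x, -, rfl⟩, _, ⟨y, -, rfl⟩, rfl⟩ := Submodule.mem_sup.1 hv
    exact ⟨x, y, rfl⟩
  have hzero : ∀ k : ℕ, ∀ n ≤ B + k, ∀ v, h.proj n v = 0 := by
    intro k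
    induction k with
    | zero =>
      intro n hn v
      have := h.proj_mem n v
      rwa [hB n (by simpa using hn), Submodule.mem_bot] at this
    | succ k ih =>
      intro n hn v
      obtain ⟨x, y, rfl⟩ := hdec v
      rw [map_add, h.proj_X_smul, h.proj_X_smul, ih, ih, smul_zero, smul_zero, add_zero]
      · simp only [weight, Matrix.cons_val_one, Matrix.cons_val_fin_one]; push_cast at hn; omega
      · simp only [weight, Matrix.cons_val_zero]; push_cast at hn; omega
  exact h.eq_zero_of_proj fun n =>
    hzero (n - B).toNat n (by have := Int.self_le_toNat (n - B); omega) v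

theorem IsGradedModule.finite_component [Module.Finite (MvPolynomial (Fin 2) F) M]
    (h : IsGradedModule α β ℳ) (hα : 0 < α) (hβ : 0 < β) (n : ℤ) : Module.Finite F (ℳ n) := by
  obtain ⟨B, hB⟩ := h.component_bddBelow
  obtain ⟨S, hSf, hS⟩ :=
    exists_finite_span_add_X_smul (F := F) (⊤ : Submodule (MvPolynomial (Fin 2) F) M)
  suffices ∀ k : ℕ, ∀ n ≤ B + k, Module.Finite F (ℳ n) from
    this (n - B).toNat n (by have := Int.self_le_toNat (n - B); omega)
  intro k
  induction k with
  | zero =>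
    intro n hn
    rw [hB n (by simpa using hn)]
    infer_instance
  | succ k ih =>
    intro n hn
    have h0 : Module.Finite F (ℳ (n - weight α β 0)) :=
      ih _ (by simp only [weight, Matrix.cons_val_zero]; push_cast at hn; omega)
    have h1 : Module.Finite F (ℳ (n - weight α β 1)) :=
      ih _ (by simp only [weight, Matrix.cons_val_one, Matrix.cons_val_fin_one]
               push_cast at hn; omega)
    have hle : ℳ n ≤ (Submodule.span F S).map (h.proj n) ⊔
        (ℳ (n - weight α β 0)).map (Module.toModuleEnd F (S := MvPolynomial (Fin 2) F) M (X 0)) ⊔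
        (ℳ (n - weight α β 1)).map (Module.toModuleEnd F (S := MvPolynomial (Fin 2) F) M (X 1)) := by
      intro v hv
      obtain ⟨y, hy, x, -, z, -, hvy⟩ := hS v trivial
      rw [← h.proj_of_mem hv, hvy, map_add, map_add, h.proj_X_smul, h.proj_X_smul]
      exact add_mem (Submodule.mem_sup_left (add_mem
        (Submodule.mem_sup_left ⟨y, hy, rfl⟩)
        (Submodule.mem_sup_right ⟨_, h.proj_mem _ x, rfl⟩)))
        (Submodule.mem_sup_right ⟨_, h.proj_mem _ z, rfl⟩)
    have : (Submodule.span F S).FG := ⟨hSf.toFinset, by simp⟩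
    rw [Module.Finite.iff_fg] at h0 h1
    have hfg := ((this.map (h.proj n)).sup
      (h0.map (Module.toModuleEnd F (S := MvPolynomial (Fin 2) F) M (X 0)))).sup
      (h1.map (Module.toModuleEnd F (S := MvPolynomial (Fin 2) F) M (X 1)))
    rw [← Module.Finite.iff_fg] at hfg
    exact Submodule.finiteDimensional_of_le hle

/-- In large degrees the Koszul complex of the two variables on a finitely generated graded module
is exact: its homology modules are finitely generated and killed by both variables. -/
theorem IsGradedModule.koszul_exact [Module.Finite (MvPolynomial (Fin 2) F) M]
    (h : IsGradedModule α β ℳ) : ∃ B : ℤ, ∀ n ≥ B,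
      (∀ v ∈ ℳ n, ∃ x ∈ ℳ (n - α), ∃ y ∈ ℳ (n - β),
        v = (X 0 : MvPolynomial (Fin 2) F) • x + (X 1 : MvPolynomial (Fin 2) F) • y) ∧
      (∀ x ∈ ℳ (n - α), ∀ y ∈ ℳ (n - β),
        (X 0 : MvPolynomial (Fin 2) F) • x + (X 1 : MvPolynomial (Fin 2) F) • y = 0 →
        ∃ v ∈ ℳ (n - α - β), x = (X 1 : MvPolynomial (Fin 2) F) • v ∧
          y = -((X 0 : MvPolynomial (Fin 2) F) • v)) ∧
      ∀ v ∈ ℳ (n - α - β), (X 0 : MvPolynomial (Fin 2) F) • v = 0 →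
        (X 1 : MvPolynomial (Fin 2) F) • v = 0 → v = 0 := by
  have w0 : weight α β 0 = α := rfl
  have w1 : weight α β 1 = β := rfl
  -- generators, up to `X₀ Z + X₁ Z`, of the cycles `Z` in the three places of the complex
  obtain ⟨S₀, hS₀f, hS₀⟩ :=
    exists_finite_span_add_X_smul (F := F) (⊤ : Submodule (MvPolynomial (Fin 2) F) M)
  obtain ⟨S₁, hS₁f, hS₁⟩ := exists_finite_span_add_X_smul (F := F)
    (LinearMap.ker ((X 0 : MvPolynomial (Fin 2) F) • LinearMap.fst (MvPolynomial (Fin 2) F) M M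
      + (X 1 : MvPolynomial (Fin 2) F) • LinearMap.snd (MvPolynomial (Fin 2) F) M M))
  obtain ⟨S₂, hS₂f, hS₂⟩ := exists_finite_span_add_X_smul (F := F)
    (LinearMap.ker ((X 0 : MvPolynomial (Fin 2) F) •
        LinearMap.id (R := MvPolynomial (Fin 2) F) (M := M))
      ⊓ LinearMap.ker ((X 1 : MvPolynomial (Fin 2) F) •
        LinearMap.id (R := MvPolynomial (Fin 2) F) (M := M)))
  obtain ⟨B₀, hB₀⟩ := h.exists_bound_of_finite hS₀f
  obtain ⟨B₁, hB₁⟩ := h.exists_bound_of_finite (hS₁f.image Prod.fst)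
  obtain ⟨B₁', hB₁'⟩ := h.exists_bound_of_finite (hS₁f.image Prod.snd)
  obtain ⟨B₂, hB₂⟩ := h.exists_bound_of_finite hS₂f
  refine ⟨|B₀| + |B₁| + |B₁'| + |B₂| + α + β, fun n hn => ⟨fun v hv => ?_, fun x hx y hy hxy => ?_,
    fun v hv hv0 hv1 => ?_⟩⟩
  · obtain ⟨s, hs, x, -, y, -, hvs⟩ := hS₀ v trivial
    refine ⟨_, h.proj_mem _ x, _, h.proj_mem _ y, ?_⟩
    have hs0 : h.proj n s = 0 := hB₀ n (by
      have := le_abs_self n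
      have := le_abs_self B₀
      have := abs_nonneg B₁
      have := abs_nonneg B₁'
      have := abs_nonneg B₂
      omega) s hs
    rw [← h.proj_of_mem hv, hvs, map_add, map_add, h.proj_X_smul, h.proj_X_smul, hs0, zero_add]
    rfl
  · obtain ⟨s, hs, p, hp, q, hq, hvs⟩ := hS₁ (x, y) (by simpa using hxy)
    have hs1 : h.proj (n - α) s.1 = 0 := by
      refine hB₁ _ ?_ _ ?_
      · have := le_abs_self (n - α)
        have := le_abs_self B₁
        have := abs_nonneg B₀
        have := abs_nonneg B₁'
        have := abs_nonneg B₂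
        omega
      · have := Submodule.mem_map_of_mem (f := LinearMap.fst F M M) hs
        rwa [Submodule.map_span] at this
    have hs2 : h.proj (n - β) s.2 = 0 := by
      refine hB₁' _ ?_ _ ?_
      · have := le_abs_self (n - β)
        have := le_abs_self B₁'
        have := abs_nonneg B₀
        have := abs_nonneg B₁
        have := abs_nonneg B₂
        omega
      · have := Submodule.mem_map_of_mem (f := LinearMap.snd F M M) hs
        rwa [Submodule.map_span] at this
    replace hp : (X 0 : MvPolynomial (Fin 2) F) • p.1 = -((X 1 : MvPolynomial (Fin 2) F) • p.2) := by
      simpa [add_eq_zero_iff_eq_neg] using hp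
    replace hq : (X 1 : MvPolynomial (Fin 2) F) • q.2 = -((X 0 : MvPolynomial (Fin 2) F) • q.1) := by
      rw [← add_eq_zero_iff_eq_neg, add_comm]; simpa using hq
    -- modulo the span of the generators, `(x, y)` is the Koszul boundary of `q.1 - p.2`
    refine ⟨h.proj (n - α - β) (q.1 - p.2), h.proj_mem _ _, ?_, ?_⟩
    · have hx' : x = s.1 + (X 1 : MvPolynomial (Fin 2) F) • (q.1 - p.2) := by
        have := congrArg Prod.fst hvs
        simp only [Prod.fst_add, Prod.smul_fst] at this
        rw [this, hp, smul_sub]; abel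
      have e : h.proj (n - α) ((X 1 : MvPolynomial (Fin 2) F) • (q.1 - p.2)) = _ :=
        h.proj_X_smul 1 (n - α) (q.1 - p.2)
      rw [w1] at e
      rw [← e, ← h.proj_of_mem hx, hx', map_add, hs1, zero_add]
    · have hy' : y = s.2 - (X 0 : MvPolynomial (Fin 2) F) • (q.1 - p.2) := by
        have := congrArg Prod.snd hvs
        simp only [Prod.snd_add, Prod.smul_snd] at this
        rw [this, hq, smul_sub]; abel
      have e : h.proj (n - β) ((X 0 : MvPolynomial (Fin 2) F) • (q.1 - p.2)) = _ :=
        h.proj_X_smul 0 (n - β) (q.1 - p.2)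
      rw [w0, sub_right_comm] at e
      rw [← e, ← h.proj_of_mem hy, hy', map_sub, hs2, zero_sub]
  · obtain ⟨s, hs, p, hp, q, hq, hvs⟩ := hS₂ v (by
      simp only [Submodule.mem_inf, LinearMap.mem_ker, LinearMap.smul_apply, LinearMap.id_apply]
      exact ⟨hv0, hv1⟩)
    simp only [Submodule.mem_inf, LinearMap.mem_ker, LinearMap.smul_apply,
      LinearMap.id_apply] at hp hq
    rw [← h.proj_of_mem hv, hvs, hp.1, hq.2, add_zero, add_zero]
    refine hB₂ _ ?_ s hs
    have := le_abs_self (n - α - β)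
    have := le_abs_self B₂
    have := abs_nonneg B₀
    have := abs_nonneg B₁
    have := abs_nonneg B₁'
    omega

end FiniteGradedModule

/-- The coefficients of `(1 - t^α)(1 - t^β) f(t)`. -/
def koszulDiff (α β : ℕ) (f : ℤ → ℤ) (n : ℤ) : ℤ := f n - f (n - α) - f (n - β) + f (n - α - β)

/-- The Hilbert series is a Laurent polynomial divided by `(1 - t^α)(1 - t^β)`. -/
theorem IsGradedModule.koszulDiff_eventually_zero {F : Type u} [Field F] {α β : ℕ} {M : Type v}
    [AddCommGroup M] [Module F M] [Module (MvPolynomial (Fin 2) F) M]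
    [IsScalarTower F (MvPolynomial (Fin 2) F) M] [Module.Finite (MvPolynomial (Fin 2) F) M]
    {ℳ : ℤ → Submodule F M} (h : IsGradedModule α β ℳ) (hα : 0 < α) (hβ : 0 < β) :
    ∃ B : ℤ, ∀ n ≥ B, koszulDiff α β (fun n => hilbertFunction ℳ n) n = 0 := by
  obtain ⟨B, hB⟩ := h.koszul_exact
  refine ⟨B, fun n hn => ?_⟩
  obtain ⟨h0, h1, h2⟩ := hB n hn
  have hfin := h.finite_component hα hβ
  let x : M →ₗ[F] M := Module.toModuleEnd F (S := MvPolynomial (Fin 2) F) M (X 0)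
  let y : M →ₗ[F] M := Module.toModuleEnd F (S := MvPolynomial (Fin 2) F) M (X 1)
  have hx : ∀ k v, v ∈ ℳ k → x v ∈ ℳ (k + α) := fun k v hv => h.X_smul_mem 0 hv
  have hy : ∀ k v, v ∈ ℳ k → y v ∈ ℳ (k + β) := fun k v hv => h.X_smul_mem 1 hv
  let φ : ℳ (n - α - β) →ₗ[F] ℳ (n - α) × ℳ (n - β) :=
    (y.restrict fun v hv => by simpa using hy _ v hv).prod
      (-(x.restrict fun v hv => by
        have := hx _ v hv
        rwa [show n - (α : ℤ) - β + α = n - β by ring] at this))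
  let ψ : ℳ (n - α) × ℳ (n - β) →ₗ[F] ℳ n :=
    (x.restrict fun v hv => by simpa using hx _ v hv).coprod
      (y.restrict fun v hv => by simpa using hy _ v hv)
  have hφ : LinearMap.ker φ = ⊥ := by
    rw [LinearMap.ker_eq_bot']
    intro v hv
    have e1 := congrArg (fun p => (p.1 : M)) hv
    have e2 := congrArg (fun p => (p.2 : M)) hv
    simp only [φ, LinearMap.prod_apply, Function.prod] at e1 e2
    exact Subtype.ext (h2 v v.2 (neg_eq_zero.1 e2) e1)
  have hψ : LinearMap.range ψ = ⊤ := by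
    rw [LinearMap.range_eq_top]
    intro v
    obtain ⟨a, ha, b, hb, hv⟩ := h0 v v.2
    exact ⟨(⟨a, ha⟩, ⟨b, hb⟩), Subtype.ext hv.symm⟩
  have hex : LinearMap.range φ = LinearMap.ker ψ := by
    apply le_antisymm
    · rintro _ ⟨v, rfl⟩
      apply Subtype.ext
      change (X 0 : MvPolynomial (Fin 2) F) • (X 1 : MvPolynomial (Fin 2) F) • (v : M)
        + (X 1 : MvPolynomial (Fin 2) F) • -((X 0 : MvPolynomial (Fin 2) F) • (v : M)) = 0
      rw [smul_neg, smul_comm, add_neg_cancel]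
    · rintro ⟨a, b⟩ hab
      obtain ⟨v, hv, ha, hb⟩ := h1 a a.2 b b.2 (congrArg Subtype.val hab)
      exact ⟨⟨v, hv⟩, Prod.ext (Subtype.ext ha.symm) (Subtype.ext hb.symm)⟩
  have d1 := φ.finrank_range_add_finrank_ker
  have d2 := ψ.finrank_range_add_finrank_ker
  rw [hφ, finrank_bot, add_zero, hex] at d1
  rw [hψ, finrank_top, d1, Module.finrank_prod] at d2
  simp only [koszulDiff, hilbertFunction]
  omega

/-! ### Depth and the necessity of `(⋆)` -/

section Depth

variable {F : Type u} [Field F] {α β : ℕ} {N : Type v} [AddCommGroup N]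
  [Module (MvPolynomial (Fin 2) F) N]

/-- Positive depth means that the ideal `(X₀, X₁)` contains a nonzerodivisor, except if
`(X₀, X₁) N = N`. -/
theorem depth_pos_iff : 0 < depth F N ↔
    Ideal.span {(X 0 : MvPolynomial (Fin 2) F), X 1} •
        (⊤ : Submodule (MvPolynomial (Fin 2) F) N) = ⊤ ∨
      ∃ r ∈ Ideal.span {(X 0 : MvPolynomial (Fin 2) F), X 1}, IsSMulRegular N r := by
  rw [depth, idealGrade]
  split_ifs with htop
  · simp [htop]
  · simp only [htop, false_or, lt_sSup_iff]
    constructor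
    · rintro ⟨_, ⟨rs, hrs, hreg, rfl⟩, hpos⟩
      cases rs with
      | nil => simp at hpos
      | cons r rs =>
        exact ⟨r, hrs r (by simp), ((RingTheory.Sequence.isRegular_cons_iff N r rs).1 hreg).1⟩
    · rintro ⟨r, hr, hreg⟩
      refine ⟨1, ⟨[r], by simpa using hr, ⟨?_, fun h => htop ?_⟩, by simp⟩, zero_lt_one⟩
      · exact .cons hreg (.nil _ _)
      · rw [Ideal.ofList_singleton] at h
        exact top_le_iff.1 (h.le.trans
          (Submodule.smul_mono_left ((Ideal.span_singleton_le_iff_mem _).2 hr)))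

/-- In a graded module of positive depth, no nonzero element is killed by powers of both
variables. -/
theorem IsGradedModule.eq_zero_of_pow_smul_eq_zero [Module F N]
    [IsScalarTower F (MvPolynomial (Fin 2) F) N] [Module.Finite (MvPolynomial (Fin 2) F) N]
    {𝒩 : ℤ → Submodule F N} (h : IsGradedModule α β 𝒩) (hα : 0 < α) (hβ : 0 < β)
    (hd : 0 < depth F N) {v : N} {a b : ℕ}
    (ha : (X 0 ^ a : MvPolynomial (Fin 2) F) • v = 0)
    (hb : (X 1 ^ b : MvPolynomial (Fin 2) F) • v = 0) : v = 0 := by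
  rcases depth_pos_iff.1 hd with htop | ⟨r, hr, hreg⟩
  · exact h.eq_zero_of_smul_top hα hβ htop v
  · obtain ⟨p, q, rfl⟩ := Ideal.mem_span_pair.1 hr
    have hmem : (p * X 0 + q * X 1) ^ (a + b) ∈
        LinearMap.ker (LinearMap.toSpanSingleton (MvPolynomial (Fin 2) F) N v) := by
      have hI : Ideal.span {(X 0 ^ a : MvPolynomial (Fin 2) F), X 1 ^ b} ≤
          LinearMap.ker (LinearMap.toSpanSingleton (MvPolynomial (Fin 2) F) N v) := by
        rw [Ideal.span_le]
        rintro _ (rfl | rfl) <;> simpa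
      refine hI ?_
      have := Ideal.add_pow_add_pred_mem_of_pow_mem
        (Ideal.span {(X 0 ^ a : MvPolynomial (Fin 2) F), X 1 ^ b}) (m := a) (n := b)
        (a := p * X 0) (b := q * X 1)
        (by rw [mul_pow]; exact Ideal.mul_mem_left _ _ (Ideal.subset_span (by simp)))
        (by rw [mul_pow]; exact Ideal.mul_mem_left _ _ (Ideal.subset_span (by simp)))
      exact Ideal.pow_mem_of_pow_mem _ this (Nat.sub_le _ _)
    exact hreg.pow (a + b) (by simpa using hmem)

end Depth

/-- If a pencil `T₁ + t T₂` of linear maps is injective on vectors with polynomial coefficients,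
then the dimension does not drop. -/
theorem finrank_le_of_pencil {K V W : Type*} [Field K] [AddCommGroup V] [Module K V]
    [AddCommGroup W] [Module K W] [FiniteDimensional K V] [FiniteDimensional K W]
    (T₁ T₂ : V →ₗ[K] W)
    (hT : ∀ (v : ℕ → V) (D : ℕ), T₁ (v 0) = 0 → (∀ l, T₁ (v (l + 1)) = T₂ (v l)) →
      (∀ l, D ≤ l → v l = 0) → v = 0) :
    Module.finrank K V ≤ Module.finrank K W := by
  -- compare dimensions on vectors of degree at most `dim W`
  set D := Module.finrank K W with hD
  let e : (Fin (D + 1) → V) →ₗ[K] (ℕ → V) := LinearMap.pi fun l =>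
    if hl : l < D + 1 then LinearMap.proj ⟨l, hl⟩ else 0
  let Φ : (Fin (D + 1) → V) →ₗ[K] (Fin (D + 2) → W) := LinearMap.pi fun l =>
    Fin.cases (T₁ ∘ₗ LinearMap.proj 0 ∘ₗ e)
      (fun l => T₁ ∘ₗ LinearMap.proj (l.val + 1) ∘ₗ e - T₂ ∘ₗ LinearMap.proj l.val ∘ₗ e) l
  have he : ∀ v l, D + 1 ≤ l → e v l = 0 := by
    intro v l hl
    simp [e, show ¬ l ≤ D by omega]
  have hΦ : Function.Injective Φ := by
    rw [← LinearMap.ker_eq_bot, LinearMap.ker_eq_bot']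
    intro v hv
    have hev := hT (e v) (D + 1) (congrFun hv 0) (fun l => by
      by_cases hl : l < D + 1
      · have := congrFun hv (Fin.succ ⟨l, hl⟩)
        exact sub_eq_zero.1 this
      · rw [he v l (by omega), he v (l + 1) (by omega), map_zero, map_zero]) (he v)
    ext l
    have := congrFun hev l
    simpa [e, show (l : ℕ) ≤ D by omega] using this
  have hle := LinearMap.finrank_le_finrank_of_injective hΦ
  rw [Module.finrank_pi_fintype, Module.finrank_pi_fintype] at hle
  simp only [Finset.sum_const, Finset.card_univ, Fintype.card_fin, smul_eq_mul, ← hD] at hle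
  by_contra! hlt
  nlinarith

/-- The Hilbert function of a module of positive depth satisfies `(⋆)`. The maps
`v ↦ X₀ ^ a v` and `v ↦ X₁ ^ b v` between the components of a fundamental couple form a pencil as
in `finrank_le_of_pencil`: the entries of a vector in the kernel form a chain in which each entry,
multiplied with a power of `X₀`, is the next one multiplied with a power of `X₁`. -/
theorem IsGradedModule.starCondition_of_depth_pos {F : Type u} [Field F] {α β : ℕ} {N : Type v}
    [AddCommGroup N] [Module F N] [Module (MvPolynomial (Fin 2) F) N]
    [IsScalarTower F (MvPolynomial (Fin 2) F) N]
    [Module.Finite (MvPolynomial (Fin 2) F) N] {𝒩 : ℤ → Submodule F N}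
    (h : IsGradedModule α β 𝒩) (hα : 0 < α) (hβ : 0 < β) (hd : 0 < depth F N) :
    StarCondition α β (hilbertFunction 𝒩) := by
  intro n m i j hij
  have hfin := h.finite_component hα hβ
  have hA : ∀ k, ∃ a : ℕ, j k = i k + a * α := by
    intro k
    obtain ⟨c, hc⟩ := (hij.modEq_left k).dvd
    have h1 := hij.lt_left k
    have hc0 : 0 ≤ c := by
      by_contra! hneg
      have : (α : ℤ) * c ≤ 0 := mul_nonpos_of_nonneg_of_nonpos (by positivity) hneg.le
      omega
    exact ⟨c.toNat, by rw [Int.toNat_of_nonneg hc0]; linarith⟩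
  have hB : ∀ k : Fin m, ∃ b : ℕ, j k.castSucc = i k.succ + b * β := by
    intro k
    obtain ⟨c, hc⟩ := (hij.modEq_right k).symm.dvd
    have h1 := hij.lt_right k
    have hc0 : 0 ≤ c := by
      by_contra! hneg
      have : (β : ℤ) * c ≤ 0 := mul_nonpos_of_nonneg_of_nonpos (by positivity) hneg.le
      omega
    exact ⟨c.toNat, by rw [Int.toNat_of_nonneg hc0]; linarith⟩
  have hB' : ∃ b : ℕ, j (Fin.last m) = i 0 + b * β := by
    obtain ⟨c, hc⟩ := hij.modEq_last.symm.dvd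
    have h1 := hij.le_last
    have hc0 : 0 ≤ c := by
      by_contra! hneg
      have : (β : ℤ) * c < 0 := mul_neg_of_pos_of_neg (by positivity) hneg
      omega
    exact ⟨c.toNat, by rw [Int.toNat_of_nonneg hc0]; linarith⟩
  choose a ha using hA
  choose b hb using hB
  obtain ⟨b', hb'⟩ := hB'
  let xpow (c : ℕ) : N →ₗ[F] N := Module.toModuleEnd F (S := MvPolynomial (Fin 2) F) N (X 0 ^ c)
  let ypow (c : ℕ) : N →ₗ[F] N := Module.toModuleEnd F (S := MvPolynomial (Fin 2) F) N (X 1 ^ c)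
  have hx : ∀ k, ∀ v ∈ 𝒩 (i k + n), xpow (a k) v ∈ 𝒩 (j k + n) := by
    intro k v hv
    have := h.X_pow_smul_mem 0 hv (a k)
    rwa [show i k + n + a k * weight α β 0 = j k + n by rw [ha]; simp [weight]; ring] at this
  have hy : ∀ k : Fin m, ∀ v ∈ 𝒩 (i k.succ + n), ypow (b k) v ∈ 𝒩 (j k.castSucc + n) := by
    intro k v hv
    have := h.X_pow_smul_mem 1 hv (b k)
    rwa [show i k.succ + n + b k * weight α β 1 = j k.castSucc + n by
      rw [hb]; simp [weight]; ring] at this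
  have hy' : ∀ v ∈ 𝒩 (i 0 + n), ypow b' v ∈ 𝒩 (j (Fin.last m) + n) := by
    intro v hv
    have := h.X_pow_smul_mem 1 hv b'
    rwa [show i 0 + n + b' * weight α β 1 = j (Fin.last m) + n by
      rw [hb']; simp [weight]; ring] at this
  let T₁ : (Π k, 𝒩 (i k + n)) →ₗ[F] (Π k, 𝒩 (j k + n)) := LinearMap.pi fun k =>
    Fin.lastCases ((xpow _).restrict (hx _) ∘ₗ LinearMap.proj _)
      (fun k => (xpow _).restrict (hx _) ∘ₗ LinearMap.proj _
        - (ypow _).restrict (hy k) ∘ₗ LinearMap.proj k.succ) k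
  let T₂ : (Π k, 𝒩 (i k + n)) →ₗ[F] (Π k, 𝒩 (j k + n)) := LinearMap.pi fun k =>
    Fin.lastCases ((ypow _).restrict hy' ∘ₗ LinearMap.proj _) (fun k => 0) k
  have hT₁ : ∀ v (k : Fin m), (T₁ v k.castSucc : N) =
      (X 0 ^ a k.castSucc : MvPolynomial (Fin 2) F) • (v k.castSucc : N)
        - (X 1 ^ b k : MvPolynomial (Fin 2) F) • (v k.succ : N) := by
    intro v k
    simp only [T₁, LinearMap.pi_apply, Fin.lastCases_castSucc]
    rfl
  have hT₁' : ∀ v, (T₁ v (Fin.last m) : N) =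
      (X 0 ^ a (Fin.last m) : MvPolynomial (Fin 2) F) • (v (Fin.last m) : N) := by
    intro v
    simp only [T₁, LinearMap.pi_apply, Fin.lastCases_last]
    rfl
  have hT₂ : ∀ v (k : Fin m), (T₂ v k.castSucc : N) = 0 := by
    intro v k
    simp only [T₂, LinearMap.pi_apply, Fin.lastCases_castSucc]
    rfl
  have hT₂' : ∀ v, (T₂ v (Fin.last m) : N) =
      (X 1 ^ b' : MvPolynomial (Fin 2) F) • (v 0 : N) := by
    intro v
    simp only [T₂, LinearMap.pi_apply, Fin.lastCases_last]
    rfl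
  have := finrank_le_of_pencil T₁ T₂ (fun v D h0 hs hD => ?_)
  · simpa only [Module.finrank_pi_fintype, hilbertFunction] using this
  -- being killed by a power of `X t` can be transported along the chain
  have htrans : ∀ (s t : Fin 2) (c d : ℕ) (p q : N),
      (X s ^ c : MvPolynomial (Fin 2) F) • p = (X t ^ d : MvPolynomial (Fin 2) F) • q →
      (∃ e : ℕ, (X s ^ e : MvPolynomial (Fin 2) F) • q = 0) →
      ∃ e : ℕ, (X s ^ e : MvPolynomial (Fin 2) F) • p = 0 := by
    rintro s t c d p q hpq ⟨e, he⟩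
    exact ⟨e + c, by rw [pow_add, mul_smul, hpq, smul_comm, he, smul_zero]⟩
  have hcast : ∀ l (k : Fin m), (X 0 ^ a k.castSucc : MvPolynomial (Fin 2) F) •
      (v l k.castSucc : N) = (X 1 ^ b k : MvPolynomial (Fin 2) F) • (v l k.succ : N) := by
    intro l k
    rw [← sub_eq_zero, ← hT₁]
    cases l with
    | zero => rw [h0]; rfl
    | succ l => rw [hs, hT₂]
  have hlast : ∀ l, (X 0 ^ a (Fin.last m) : MvPolynomial (Fin 2) F) • (v (l + 1) (Fin.last m) : N)
      = (X 1 ^ b' : MvPolynomial (Fin 2) F) • (v l 0 : N) := by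
    intro l
    rw [← hT₁', hs, hT₂']
  -- start at the entries of `v 0`, where the chain of entries begins
  have hX : ∀ l k, ∃ e : ℕ, (X 0 ^ e : MvPolynomial (Fin 2) F) • (v l k : N) = 0 := by
    intro l
    induction l with
    | zero =>
      intro k
      induction k using Fin.reverseInduction with
      | last => exact ⟨a (Fin.last m), by rw [← hT₁', h0]; rfl⟩
      | cast k ih => exact htrans _ _ _ _ _ _ (hcast 0 k) ih
    | succ l ihl =>
      intro k
      induction k using Fin.reverseInduction with
      | last => exact htrans _ _ _ _ _ _ (hlast l) (ihl 0)
      | cast k ih => exact htrans _ _ _ _ _ _ (hcast (l + 1) k) ih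
  -- start beyond the degree of `v`, where all entries are zero
  have hY : ∀ d l, D ≤ l + d → ∀ k, ∃ e : ℕ,
      (X 1 ^ e : MvPolynomial (Fin 2) F) • (v l k : N) = 0 := by
    intro d
    induction d with
    | zero => intro l hl k; exact ⟨0, by rw [hD l hl]; exact smul_zero _⟩
    | succ d ihd =>
      intro l hl k
      induction k using Fin.induction with
      | zero => exact htrans _ _ _ _ _ _ (hlast l).symm (ihd (l + 1) (by omega) _)
      | succ k ih => exact htrans _ _ _ _ _ _ (hcast l k).symm ih
  funext l
  ext k
  obtain ⟨c, hc⟩ := hX l k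
  obtain ⟨d, hd'⟩ := hY D l (by omega) k
  exact h.eq_zero_of_pow_smul_eq_zero hα hβ hd hc hd'

/-! ### Gaps of the numerical semigroup -/

section Gaps

variable {α β : ℕ}

theorem gaps_comm (α β : ℕ) : gaps α β = gaps β α := by
  rw [gaps, gaps, Set.pair_comm]

theorem sub_mem_gaps (hαβ : α.Coprime β) (hα : 0 < α) (hβ : 0 < β) {p q : ℕ} (hp : p < β)
    (hq : 0 < q) (h : 0 ≤ (α * p - β * q : ℤ)) : (α * p - β * q : ℤ) ∈ gaps α β := by
  refine ⟨(α * p - β * q : ℤ).toNat, fun hmem => ?_, Int.toNat_of_nonneg h⟩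
  obtain ⟨r, s, hrs⟩ := (AddSubmonoid.mem_closure_pair _ _ _).1 hmem
  -- `α (p - r) = β (q + s)` is positive, which forces `β ≤ p - r`
  have heq : (α : ℤ) * (p - r) = β * (q + s) := by
    have := congrArg (Nat.cast : ℕ → ℤ) hrs
    rw [Int.toNat_of_nonneg h] at this
    push_cast [smul_eq_mul] at this
    linarith
  have hdvd : (β : ℤ) ∣ p - r :=
    (Nat.isCoprime_iff_coprime.2 hαβ).symm.dvd_of_dvd_mul_left ⟨_, heq⟩
  have hpos : 0 < (p - r : ℤ) := by
    have : 0 < (α : ℤ) * (p - r) := by rw [heq]; positivity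
    exact pos_of_mul_pos_right this (by positivity)
  have := Int.le_of_dvd hpos hdvd
  omega

theorem abs_sub_mem_gaps (hαβ : α.Coprime β) (hα : 0 < α) (hβ : 0 < β) {p q : ℕ} (hp : 0 < p)
    (hp' : p < β) (hq : 0 < q) (hq' : q < α) : |(α * p - β * q : ℤ)| ∈ gaps α β := by
  rcases le_total 0 (α * p - β * q : ℤ) with h | h
  · rw [abs_of_nonneg h]
    exact sub_mem_gaps hαβ hα hβ hp' hq h
  · rw [abs_of_nonpos h, neg_sub, gaps_comm]
    exact sub_mem_gaps hαβ.symm hβ hα hq' hp (by linarith)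

end Gaps

/-! ### Closed walks -/

section Walks

/-- The end point of the walk on `ℤ` from `x` in which a letter `true` is a step `+α` and a letter
`false` a step `-β`. -/
def walkEnd (α β : ℕ) : ℤ → List Bool → ℤ
  | x, [] => x
  | x, true :: s => walkEnd α β (x + α) s
  | x, false :: s => walkEnd α β (x - β) s

/-- The total increment of `h` along the steps `+α` of a walk. -/
def walkCost (α β : ℕ) (h : ℤ → ℤ) : ℤ → List Bool → ℤ
  | _, [] => 0
  | x, true :: s => h (x + α) - h x + walkCost α β h (x + α) s
  | x, false :: s => walkCost α β h (x - β) s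

variable {α β : ℕ} {h : ℤ → ℤ}

theorem walkEnd_eq (x : ℤ) (s : List Bool) :
    walkEnd α β x s = x + α * s.count true - β * s.count false := by
  induction s generalizing x with
  | nil => simp [walkEnd]
  | cons c s ih => cases c <;> simp [walkEnd, ih] <;> ring

theorem walkEnd_append (x : ℤ) (s t : List Bool) :
    walkEnd α β x (s ++ t) = walkEnd α β (walkEnd α β x s) t := by
  simp only [walkEnd_eq, List.count_append]; push_cast; ring

theorem walkCost_append (x : ℤ) (s t : List Bool) :
    walkCost α β h x (s ++ t) = walkCost α β h x s + walkCost α β h (walkEnd α β x s) t := by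
  induction s generalizing x with
  | nil => simp [walkEnd, walkCost]
  | cons c s ih => cases c <;> simp [walkEnd, walkCost, ih, add_assoc]

theorem walkCost_replicate_true (x : ℤ) (a : ℕ) :
    walkCost α β h x (List.replicate a true) = h (x + α * a) - h x := by
  induction a generalizing x with
  | zero => simp [walkCost]
  | succ a ih => rw [List.replicate_succ, walkCost, ih]; push_cast; ring_nf

theorem walkCost_replicate_false (x : ℤ) (b : ℕ) :
    walkCost α β h x (List.replicate b false) = 0 := by
  induction b generalizing x with
  | zero => rfl
  | succ b ih => rw [List.replicate_succ, walkCost, ih]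

theorem walkEnd_eq_self_iff {x : ℤ} {s : List Bool} :
    walkEnd α β x s = x ↔ α * s.count true = β * s.count false := by
  rw [walkEnd_eq]
  constructor <;> intro h
  · exact_mod_cast (by linarith : (α * s.count true : ℤ) = β * s.count false)
  · have : (α * s.count true : ℤ) = β * s.count false := by exact_mod_cast h
    linarith

theorem count_of_closed_of_length (hα : 0 < α) {x : ℤ} {s : List Bool}
    (hs : walkEnd α β x s = x) (hlen : s.length = α + β) :
    s.count true = β ∧ s.count false = α := by
  rw [walkEnd_eq_self_iff] at hs
  have hsum : s.count true + s.count false = α + β := by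
    rw [← hlen, List.count_true_add_count_false]
  have hT : s.count true = β := by
    apply Nat.eq_of_mul_eq_mul_left (show 0 < α + β by omega)
    rw [add_mul, hs, ← mul_add, add_comm (s.count false), hsum, mul_comm]
  exact ⟨hT, by omega⟩

/-- Decomposition of a walk into runs: steps `-β`, then blocks of steps `+α` followed by steps
`-β`, then steps `+α`. -/
theorem exists_runs (w : List Bool) : ∃ (b : ℕ) (ps : List (ℕ × ℕ)) (a : ℕ),
    (∀ p ∈ ps, 0 < p.1 ∧ 0 < p.2) ∧
    w = List.replicate b false ++
      ps.flatMap (fun p => List.replicate p.1 true ++ List.replicate p.2 false) ++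
      List.replicate a true := by
  induction w with
  | nil => exact ⟨0, [], 0, by simp, rfl⟩
  | cons c w ih =>
    obtain ⟨b, ps, a, hps, rfl⟩ := ih
    cases c with
    | false => exact ⟨b + 1, ps, a, hps, by simp [List.replicate_succ]⟩
    | true =>
      rcases Nat.eq_zero_or_pos b with rfl | hb
      · cases ps with
        | nil => exact ⟨0, [], a + 1, by simp, by simp [List.replicate_succ]⟩
        | cons p ps =>
          refine ⟨0, (p.1 + 1, p.2) :: ps, a, ?_, by simp [List.replicate_succ]⟩
          simp only [List.mem_cons, forall_eq_or_imp] at hps ⊢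
          exact ⟨⟨by omega, hps.1.2⟩, hps.2⟩
      · refine ⟨0, (1, b) :: ps, a, ?_, by simp⟩
        simp only [List.mem_cons, forall_eq_or_imp]
        exact ⟨⟨by omega, hb⟩, hps⟩

/-- A closed walk with `α + β` steps, starting at its minimum, is the same as a fundamental
couple: the `i k` are the valleys and the `j k` the peaks. -/
theorem walkCost_nonneg_of_min (hαβ : α.Coprime β) (hα : 0 < α) (hβ : 0 < β) {h : ℤ → ℕ}
    (hstar : StarCondition α β h) {x : ℤ} {w : List Bool} (hw : walkEnd α β x w = x)
    (hlen : w.length = α + β) (hmin : ∀ k, x ≤ walkEnd α β x (w.take k)) :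
    0 ≤ walkCost α β (fun n => h n) x w := by
  obtain ⟨hT, hF⟩ := count_of_closed_of_length hα hw hlen
  obtain ⟨b, ps, a, hps, hw'⟩ := exists_runs w
  -- a walk cannot leave its minimum downwards, nor return to it upwards
  have hb : b = 0 := by
    have := hmin b
    rw [hw', List.append_assoc, List.take_left' (by simp), walkEnd_eq] at this
    simp only [List.count_replicate] at this
    by_contra hb0
    have : (0 : ℤ) < β * b := by positivity
    simp at *
    omega
  subst hb
  have ha : a = 0 := by
    have h1 := hmin (ps.flatMap fun p => List.replicate p.1 true ++ List.replicate p.2 false).length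
    rw [hw'] at h1 hw
    simp only [List.replicate_zero, List.nil_append] at h1 hw
    rw [List.take_left' rfl] at h1
    rw [walkEnd_append, walkEnd_eq (walkEnd α β x _)] at hw
    by_contra ha0
    have : (0 : ℤ) < α * a := by positivity
    simp only [List.count_replicate] at hw
    simp at hw
    omega
  subst ha
  simp only [List.replicate_zero, List.nil_append, List.append_nil] at hw'
  set flat : List (ℕ × ℕ) → List Bool := fun ps =>
    ps.flatMap fun p => List.replicate p.1 true ++ List.replicate p.2 false
  change w = flat ps at hw'
  -- the numbers of steps `+α` and `-β` before the `k`-th valley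
  let A : ℕ → ℕ := fun k => ((ps.take k).map Prod.fst).sum
  let B : ℕ → ℕ := fun k => ((ps.take k).map Prod.snd).sum
  have hcount : ∀ qs : List (ℕ × ℕ), (flat qs).count true = (qs.map Prod.fst).sum ∧
      (flat qs).count false = (qs.map Prod.snd).sum := by
    intro qs
    induction qs with
    | nil => simp [flat]
    | cons q qs ih =>
      simp only [flat, List.flatMap_cons, List.count_append, List.map_cons, List.sum_cons] at ih ⊢
      rw [ih.1, ih.2]
      simp [List.count_replicate]
  have hend : ∀ k, walkEnd α β x (flat (ps.take k)) = x + α * A k - β * B k := by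
    intro k
    rw [walkEnd_eq, (hcount _).1, (hcount _).2]
  have hpos : ∀ k, 0 ≤ (α * A k - β * B k : ℤ) := by
    intro k
    have h1 := hmin (flat (ps.take k)).length
    have h2 : flat ps = flat (ps.take k) ++ flat (ps.drop k) := by
      simp only [flat]
      rw [← List.flatMap_append, List.take_append_drop]
    rw [hw', h2, List.take_left' rfl, hend] at h1
    linarith
  have htake : ∀ k (hk : k < ps.length), ps.take (k + 1) = ps.take k ++ [ps[k]] := by
    intro k hk
    rw [List.take_append_getElem]
  have hAs : ∀ k (hk : k < ps.length), A (k + 1) = A k + ps[k].1 := by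
    intro k hk; simp only [A, htake k hk, List.map_append, List.sum_append, List.map_cons,
      List.map_nil, List.sum_singleton]
  have hBs : ∀ k (hk : k < ps.length), B (k + 1) = B k + ps[k].2 := by
    intro k hk; simp only [B, htake k hk, List.map_append, List.sum_append, List.map_cons,
      List.map_nil, List.sum_singleton]
  have hA : ∀ k l, k < l → l ≤ ps.length → A k < A l := by
    intro k l hkl hl
    induction l, Nat.succ_le_of_lt hkl using Nat.le_induction with
    | base =>
      have h1 := hAs k hl
      have := (hps _ (List.getElem_mem hl)).1
      rw [Nat.succ_eq_add_one]
      omega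
    | succ l hkl' ih =>
      have := hAs l hl
      have := (hps _ (List.getElem_mem hl)).1
      have := ih (by omega) (by omega)
      omega
  have hB : ∀ k l, k < l → l ≤ ps.length → B k < B l := by
    intro k l hkl hl
    induction l, Nat.succ_le_of_lt hkl using Nat.le_induction with
    | base =>
      have h1 := hBs k hl
      have := (hps _ (List.getElem_mem hl)).2
      rw [Nat.succ_eq_add_one]
      omega
    | succ l hkl' ih =>
      have := hBs l hl
      have := (hps _ (List.getElem_mem hl)).2
      have := ih (by omega) (by omega)
      omega
  have hA0 : A 0 = 0 := rfl
  have hB0 : B 0 = 0 := rfl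
  have hAl : A ps.length = β := by rw [← hT, hw', (hcount ps).1]; simp only [A, List.take_length]
  have hBl : B ps.length = α := by rw [← hF, hw', (hcount ps).2]; simp only [B, List.take_length]
  have hcost : ∀ k ≤ ps.length, walkCost α β (fun n => h n) x (flat (ps.take k)) =
      ∑ l ∈ Finset.range k,
        ((h (α * A (l + 1) - β * B l + x) : ℤ) - h (α * A l - β * B l + x)) := by
    intro k hk
    induction k with
    | zero => simp [flat, walkCost]
    | succ k ih =>
      have : flat (ps.take (k + 1)) = flat (ps.take k) ++
          (List.replicate ps[k].1 true ++ List.replicate ps[k].2 false) := by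
        simp only [flat, htake k hk, List.flatMap_append, List.flatMap_singleton]
      rw [this, walkCost_append, ih (by omega), walkCost_append, walkCost_replicate_true,
        walkCost_replicate_false, hend, Finset.sum_range_succ, hAs k hk]
      push_cast
      ring_nf
  obtain ⟨m, hm⟩ : ∃ m, ps.length = m + 1 := by
    refine Nat.exists_eq_succ_of_ne_zero fun h0 => ?_
    rw [h0] at hAl
    omega
  have hcouple : IsFundamentalCouple α β (m := m) (fun k => α * A k - β * B k)
      (fun k => α * A (k + 1) - β * B k) := by
    have hAlt : ∀ k, k < m + 1 → A k < β := fun k hk => hAl ▸ hA k _ (by omega) le_rfl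
    have hBlt : ∀ k, k < m + 1 → B k < α := fun k hk => hBl ▸ hB k _ (by omega) le_rfl
    have hlt : ∀ k : Fin (m + 1), (α * A k - β * B k : ℤ) < α * A (k + 1) - β * B k := by
      intro k
      have h1 : (A k : ℤ) < A (k + 1) := by exact_mod_cast hA k (k + 1) (by omega) (by omega)
      have : (α * A k : ℤ) < α * A (k + 1) := by gcongr
      linarith
    have hk0 : ∀ k : Fin (m + 1), k ≠ 0 → 0 < (k : ℕ) := fun k hk =>
      Nat.pos_of_ne_zero fun h0 => hk (Fin.ext h0)
    exact {
      i_zero := by simp [hA0, hB0]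
      i_mem_gaps := fun k hk => sub_mem_gaps hαβ hα hβ (hAlt k k.2)
        (hB0 ▸ hB 0 k (hk0 k hk) (by omega)) (hpos k)
      j_mem_gaps := fun k hk hk' => by
        have hkm : (k : ℕ) < m := by
          rcases Nat.lt_or_ge k m with h1 | h1
          · exact h1
          · exact absurd (Fin.ext (by simp; omega)) hk'
        exact sub_mem_gaps hαβ hα hβ (hAlt (k + 1) (by omega))
          (hB0 ▸ hB 0 k (hk0 k hk) (by omega)) ((hpos k).trans (hlt k).le)
      j_zero_le := by
        have h1 : A 1 ≤ β := by
          rw [← hAl]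
          rcases Nat.eq_zero_or_pos m with rfl | h0
          · rw [hm]
          · exact (hA _ _ (by omega) le_rfl).le
        have h2 : (A 1 : ℤ) ≤ β := by exact_mod_cast h1
        simp only [Fin.val_zero, zero_add, hB0, Nat.cast_zero, mul_zero, sub_zero]
        gcongr
      j_last_le := by
        simp only [Fin.val_last]
        rw [← hm, hAl]
        have : (0 : ℤ) ≤ β * B m := by positivity
        linarith
      modEq_left := fun k => by
        refine Int.modEq_iff_dvd.2 ⟨A (k + 1) - A k, by ring⟩
      lt_left := hlt
      modEq_right := fun k => by
        refine Int.modEq_iff_dvd.2 ⟨B k - B (k + 1), ?_⟩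
        simp only [Fin.val_castSucc, Fin.val_succ]
        ring
      lt_right := fun k => by
        have h1 : (B k : ℤ) < B (k + 1) := by exact_mod_cast hB k (k + 1) (by omega) (by omega)
        have : (β * B k : ℤ) < β * B (k + 1) := by gcongr
        simp only [Fin.val_castSucc, Fin.val_succ]
        linarith
      modEq_last := by
        refine Int.modEq_iff_dvd.2 ⟨B m - α, ?_⟩
        simp only [Fin.val_last, Fin.val_zero, hA0, hB0]
        rw [← hm, hAl]
        push_cast
        ring
      le_last := by
        refine le_trans ?_ (hlt (Fin.last m)).le
        simpa [hA0, hB0] using hpos m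
      abs_sub_mem_gaps := fun k l hk hkl => by
        have hkl' : (k : ℕ) < l := hkl
        have h1 := hA k l hkl' (by omega)
        have h2 := hB k l hkl' (by omega)
        have h3 := hAlt l l.2
        have h4 := hBlt l l.2
        have := abs_sub_mem_gaps hαβ hα hβ (p := A l - A k) (q := B l - B k) (by omega) (by omega)
          (by omega) (by omega)
        rw [abs_sub_comm]
        convert this using 2
        push_cast [h1.le, h2.le]
        ring }
  have hfin := hstar x m _ _ hcouple
  have hps' : ps.take ps.length = ps := List.take_length
  rw [hw', ← hps', hcost _ le_rfl, Finset.sum_sub_distrib, hm, Finset.sum_range, Finset.sum_range,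
    sub_nonneg]
  exact_mod_cast hfin

theorem walkCost_nonneg_of_length (hαβ : α.Coprime β) (hα : 0 < α) (hβ : 0 < β) {h : ℤ → ℕ}
    (hstar : StarCondition α β h) {x : ℤ} {w : List Bool} (hw : walkEnd α β x w = x)
    (hlen : w.length = α + β) : 0 ≤ walkCost α β (fun n => h n) x w := by
  -- rotate the walk so that it starts at its minimum
  obtain ⟨t, -, ht⟩ := Finset.exists_min_image (Finset.range (w.length + 1))
    (fun t => walkEnd α β x (w.take t)) ⟨0, by simp⟩
  replace ht : ∀ k, walkEnd α β x (w.take t) ≤ walkEnd α β x (w.take k) := by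
    intro k
    rcases Nat.lt_or_ge k (w.length + 1) with hk | hk
    · exact ht k (Finset.mem_range.2 hk)
    · have := ht w.length (by simp)
      rw [List.take_length] at this
      rwa [List.take_of_length_le (show w.length ≤ k by omega)]
  have hsplit : w.take t ++ w.drop t = w := List.take_append_drop t w
  have hclosed : walkEnd α β (walkEnd α β x (w.take t)) (w.drop t) = x := by
    rw [← walkEnd_append, hsplit, hw]
  have hcost : walkCost α β (fun n => (h n : ℤ)) x w =
      walkCost α β (fun n => h n) (walkEnd α β x (w.take t)) (w.drop t ++ w.take t) := by
    conv_lhs => rw [← hsplit, walkCost_append]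
    rw [walkCost_append, hclosed, add_comm]
  rw [hcost]
  refine walkCost_nonneg_of_min hαβ hα hβ hstar ?_ ?_ fun k => ?_
  · rw [walkEnd_append, hclosed]
  · rw [List.length_append, add_comm, ← List.length_append, hsplit, hlen]
  · rw [List.take_append, walkEnd_append]
    rcases Nat.le_total k (w.drop t).length with hk | hk
    · rw [Nat.sub_eq_zero_of_le hk, List.take_zero, walkEnd, ← walkEnd_append]
      have := ht (t + k)
      rwa [List.take_add] at this
    · rw [List.take_of_length_le hk, hclosed, List.take_take]
      exact ht _

/-- A discrete intermediate value theorem for sliding windows: if `g` increases by `c b` in `c`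
windows of length `L`, then it increases by `b` in some window of length `L`. -/
theorem exists_window {g : ℕ → ℤ} {L c : ℕ} {b : ℤ} (hc : 0 < c)
    (hg : ∀ t, |(g (t + L + 1) - g (t + L)) - (g (t + 1) - g t)| ≤ 1)
    (h : g (c * L) - g 0 = c * b) : ∃ t, t + L ≤ c * L ∧ g (t + L) - g t = b := by
  have key : ∀ {g : ℕ → ℤ} {b : ℤ},
      (∀ t, |(g (t + L + 1) - g (t + L)) - (g (t + 1) - g t)| ≤ 1) → g (c * L) - g 0 = c * b →
      (∀ t, t + L ≤ c * L → g (t + L) - g t ≠ b) → b < g (0 + L) - g 0 → False := by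
    intro g b hg h hne h0
    have hwin : ∀ t, t + L ≤ c * L → b < g (t + L) - g t := by
      intro t
      induction t with
      | zero => exact fun _ => h0
      | succ t ih =>
        intro ht
        have h1 := ih (by omega)
        have h2 := abs_le.1 (hg t)
        have h3 := hne (t + 1) ht
        rw [show t + 1 + L = t + L + 1 by omega] at h3 ⊢
        omega
    have hsum : ∀ r ≤ c, r * (b + 1) ≤ g (r * L) - g 0 := by
      intro r
      induction r with
      | zero => simp
      | succ r ih =>
        intro hr
        have h1 := ih (by omega)
        have h2 := hwin (r * L) (by rw [← Nat.succ_mul]; exact Nat.mul_le_mul_right L hr)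
        rw [add_mul, one_mul] at *
        push_cast
        linarith
    have := hsum c le_rfl
    have : (0 : ℤ) < c := by exact_mod_cast hc
    linarith
  by_contra! hne
  have hcL : 0 + L ≤ c * L := by
    rw [zero_add]
    exact Nat.le_mul_of_pos_left L hc
  rcases lt_or_gt_of_ne (hne 0 hcL) with h0 | h0
  · refine key (g := fun t => -g t) (b := -b) (fun t => ?_) (by linarith) (fun t ht => ?_)
      (by linarith)
    · rw [← abs_neg]
      convert hg t using 2
      ring
    · have := hne t ht
      omega
  · exact key hg h hne h0

/-- Every closed walk decomposes into closed walks with `α + β` steps, so that `(⋆)` gives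
nonnegative cost for all closed walks. -/
theorem walkCost_nonneg_of_closed (hαβ : α.Coprime β) (hα : 0 < α) (hβ : 0 < β) {h : ℤ → ℕ}
    (hstar : StarCondition α β h) {x : ℤ} {w : List Bool} (hw : walkEnd α β x w = x) :
    0 ≤ walkCost α β (fun n => h n) x w := by
  induction hn : w.length using Nat.strong_induction_on generalizing x w with
  | _ n ih =>
  have hcount := walkEnd_eq_self_iff.1 hw
  obtain ⟨c, hc⟩ : β ∣ w.count true :=
    hαβ.symm.dvd_of_dvd_mul_left ⟨_, hcount⟩
  have hcF : w.count false = α * c := by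
    apply Nat.eq_of_mul_eq_mul_left hβ
    rw [← hcount, hc]; ring
  have hlen : w.length = c * (α + β) := by
    rw [← List.count_true_add_count_false, hc, hcF]; ring
  rcases Nat.eq_zero_or_pos c with rfl | hc0
  · rw [zero_mul, List.length_eq_zero_iff] at hlen
    rw [hlen, walkCost]
  have hstep : ∀ t, (w.take t).count true ≤ (w.take (t + 1)).count true ∧
      (w.take (t + 1)).count true ≤ (w.take t).count true + 1 := by
    intro t
    rw [List.take_add_one, List.count_append]
    cases w[t]? with
    | none => simp
    | some c => cases c <;> simp
  obtain ⟨t, ht, htb⟩ := exists_window (g := fun t => ((w.take t).count true : ℤ)) (L := α + β)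
    (b := β) hc0 (fun t => by
      have h1 := hstep t
      have h2 := hstep (t + (α + β))
      rw [abs_le]
      omega) (by
      rw [← hlen, List.take_length, hc]
      simp [mul_comm])
  -- cut out the window
  set p := w.take t
  set q := (w.drop t).take (α + β)
  set r := (w.drop t).drop (α + β)
  have hpqr : w = p ++ (q ++ r) := by simp [p, q, r]
  have hqlen : q.length = α + β := by simp [q]; omega
  have hqT : q.count true = β := by
    have : w.take (t + (α + β)) = p ++ q := List.take_add
    rw [this, List.count_append] at htb
    push_cast at htb
    omega
  have hq : ∀ y, walkEnd α β y q = y := by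
    intro y
    rw [walkEnd_eq_self_iff, hqT]
    have := List.count_true_add_count_false (l := q)
    rw [show q.count false = α by omega, mul_comm]
  have hpr : walkEnd α β x (p ++ r) = x := by
    conv_rhs => rw [← hw, hpqr]
    simp only [walkEnd_append, hq]
  have h1 := ih (p ++ r).length (by
    rw [← hn, hpqr]; simp only [List.length_append]; omega) hpr rfl
  have h2 := walkCost_nonneg_of_length hαβ hα hβ hstar (hq (walkEnd α β x p)) hqlen
  rw [hpqr]
  rw [walkCost_append] at h1
  rw [walkCost_append, walkCost_append, hq]
  linarith

/-- Condition `(⋆)` splits `h` into a part that is monotone along steps `α` and a part that is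
monotone along steps `β`. The second part at `x` is the minimal cost of a walk to `x` from the
region where `h` vanishes (a shortest path potential). -/
theorem exists_add_of_starCondition (hαβ : α.Coprime β) (hα : 0 < α) (hβ : 0 < β) {h : ℤ → ℕ}
    (hstar : StarCondition α β h) {B : ℤ} (hB : ∀ n ≤ B, h n = 0) :
    ∃ u v : ℤ → ℕ, (∀ n, h n = u n + v n) ∧ (∀ n, u n ≤ u (n + α)) ∧ ∀ n, v n ≤ v (n + β) := by
  have hα' : (0 : ℤ) < α := by exact_mod_cast hα
  have hβ' : (0 : ℤ) < β := by exact_mod_cast hβ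
  have hnonneg : ∀ p ≤ B, ∀ w, 0 ≤ walkCost α β (fun n => h n) p w := by
    intro p hp w
    -- close the walk inside the region where `h` vanishes
    set x := walkEnd α β p w with hx
    obtain ⟨c, d, hcd⟩ : ∃ c d : ℕ, x - β * d + α * c = p := by
      obtain ⟨e, f, hef⟩ := Nat.isCoprime_iff_coprime.2 hαβ
      -- a solution of Bézout's equation, shifted by a multiple of `(β, α)` to become nonnegative
      set K := |x - p| * (|e| + |f|) with hK
      refine ⟨((p - x) * e + β * K).toNat, (-((p - x) * f) + α * K).toNat, ?_⟩
      have hbound : ∀ g : ℤ, |g| ≤ |e| + |f| → |(p - x) * g| ≤ K := by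
        intro g hg
        rw [abs_mul, abs_sub_comm, hK]
        exact mul_le_mul_of_nonneg_left hg (abs_nonneg _)
      have hKpos : 0 ≤ K := by positivity
      have h1 := neg_le_of_abs_le (hbound e (by linarith [abs_nonneg f]))
      have h2 := le_of_abs_le (hbound f (by linarith [abs_nonneg e]))
      have h3 : K ≤ β * K := le_mul_of_one_le_left hKpos (by omega)
      have h4 : K ≤ α * K := le_mul_of_one_le_left hKpos (by omega)
      rw [Int.toNat_of_nonneg (by linarith), Int.toNat_of_nonneg (by linarith)]
      linear_combination (p - x) * hef
    have hclosed : walkEnd α β p (w ++ (List.replicate d false ++ List.replicate c true)) = p := by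
      rw [walkEnd_append, ← hx, walkEnd_eq]
      simp [List.count_replicate]
      linarith
    have := walkCost_nonneg_of_closed hαβ hα hβ hstar hclosed
    rw [walkCost_append, ← hx, walkCost_append, walkCost_replicate_false, walkCost_replicate_true,
      walkEnd_eq] at this
    simp only [List.count_replicate] at this
    have e1 : x - β * d ≤ B := by
      have : (0 : ℤ) ≤ α * c := by positivity
      linarith
    simp at this
    rw [hB (x - β * d + α * c) (by omega), hB _ e1] at this
    simpa using this
  let C : ℤ → Set ℕ := fun x =>
    {c | ∃ p ≤ B, ∃ w, walkEnd α β p w = x ∧ walkCost α β (fun n => h n) p w = c}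
  have hmem : ∀ x, h x ∈ C x := by
    intro x
    refine ⟨x - α * (|x| + |B|).toNat, ?_, List.replicate (|x| + |B|).toNat true, ?_, ?_⟩
    · rw [Int.toNat_of_nonneg (by positivity)]
      have : |x| + |B| ≤ α * (|x| + |B|) := le_mul_of_one_le_left (by positivity) (by omega)
      have := le_abs_self x
      have := neg_abs_le B
      linarith
    · rw [walkEnd_eq]; simp [List.count_replicate]
    · rw [walkCost_replicate_true]
      have : h (x - α * (|x| + |B|).toNat) = 0 := by
        apply hB
        rw [Int.toNat_of_nonneg (by positivity)]
        have : |x| + |B| ≤ α * (|x| + |B|) := le_mul_of_one_le_left (by positivity) (by omega)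
        have := le_abs_self x
        have := neg_abs_le B
        linarith
      rw [this, Nat.cast_zero, sub_zero, sub_add_cancel]
  let v : ℤ → ℕ := fun x => sInf (C x)
  have hv : ∀ x, v x ∈ C x := fun x => Nat.sInf_mem ⟨_, hmem x⟩
  have hvle : ∀ x (c : ℤ), (∃ p ≤ B, ∃ w, walkEnd α β p w = x ∧
      walkCost α β (fun n => h n) p w = c) → (v x : ℤ) ≤ c := by
    rintro x _ ⟨p, hp, w, hw, rfl⟩
    have h0 := hnonneg p hp w
    have hm : (walkCost α β (fun n => (h n : ℤ)) p w).toNat ∈ C (walkEnd α β p w) :=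
      ⟨p, hp, w, rfl, (Int.toNat_of_nonneg h0).symm⟩
    rw [← hw, ← Int.toNat_of_nonneg h0]
    exact_mod_cast Nat.sInf_le hm
  have hvh : ∀ x, v x ≤ h x := fun x => Nat.sInf_le (hmem x)
  refine ⟨fun x => h x - v x, v, fun x => (Nat.sub_add_cancel (hvh x)).symm,
    fun x => ?_, fun x => ?_⟩
  · obtain ⟨p, hp, w, hw, hc⟩ := hv x
    have := hvle (x + α) ((v x : ℤ) + ((h (x + α) : ℤ) - h x))
      ⟨p, hp, w ++ [true], by rw [walkEnd_append, hw]; rfl, by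
        rw [walkCost_append, hw, hc]; simp [walkCost]⟩
    have := hvh x
    have := hvh (x + α)
    change h x - v x ≤ h (x + α) - v (x + α)
    omega
  · obtain ⟨p, hp, w, hw, hc⟩ := hv (x + β)
    have := hvle x (v (x + β))
      ⟨p, hp, w ++ [false], by rw [walkEnd_append, hw]; simp [walkEnd], by
        rw [walkCost_append, hw, hc]; simp [walkCost]⟩
    exact_mod_cast this

end Walks

/-! ### Hilbert functions of modules of positive depth -/

section Realizable

/-- `f` is the Hilbert function of a finitely generated graded module on which `X₀ + X₁` is
injective. -/
def IsRealizable (F : Type u) [Field F] (α β : ℕ) (f : ℤ → ℕ) : Prop :=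
  ∃ (N : Type u) (_ : AddCommGroup N) (_ : Module F N)
    (_ : Module (MvPolynomial (Fin 2) F) N) (_ : IsScalarTower F (MvPolynomial (Fin 2) F) N)
    (𝒩 : ℤ → Submodule F N),
      Module.Finite (MvPolynomial (Fin 2) F) N ∧ IsGradedModule α β 𝒩 ∧
      hilbertFunction 𝒩 = f ∧ IsSMulRegular N (X 0 + X 1 : MvPolynomial (Fin 2) F)

variable {F : Type u} [Field F] {α β : ℕ} {f g : ℤ → ℕ}

theorem IsRealizable.hilbertDepth_pos {M : Type v} [AddCommGroup M] [Module F M]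
    {ℳ : ℤ → Submodule F M} (h : IsRealizable F α β (hilbertFunction ℳ)) :
    0 < hilbertDepth α β ℳ := by
  obtain ⟨N, _, _, _, _, 𝒩, hfin, hgr, hf, hreg⟩ := h
  refine lt_sSup_iff.2 ⟨depth F N, ⟨N, _, _, _, ‹_›, 𝒩, hfin, hgr, hf, rfl⟩, ?_⟩
  exact depth_pos_iff.2 (Or.inr ⟨X 0 + X 1,
    add_mem (Ideal.subset_span (by simp)) (Ideal.subset_span (by simp)), hreg⟩)

theorem IsRealizable.shift (h : IsRealizable F α β f) (p : ℤ) :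
    IsRealizable F α β (fun n => f (n - p)) := by
  obtain ⟨N, _, _, _, _, 𝒩, hfin, hgr, rfl, hreg⟩ := h
  refine ⟨N, _, _, _, ‹_›, fun n => 𝒩 (n - p), hfin, ⟨?_, ⟨?_⟩⟩, rfl, hreg⟩
  · have := hgr.isInternal
    rw [DirectSum.isInternal_submodule_iff_iSupIndep_and_iSup_eq_top] at this ⊢
    exact ⟨this.1.comp (sub_left_injective (b := p)),
      ((Equiv.subRight p).iSup_comp (g := 𝒩)).trans this.2⟩
  · intro i j a b ha hb
    have := hgr.gradedSMul.smul_mem ha hb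
    rwa [vadd_eq_add, ← add_sub_assoc] at this

theorem IsRealizable.zero : IsRealizable F α β fun _ => 0 := by
  refine ⟨PUnit, inferInstance, inferInstance, inferInstance, inferInstance, fun _ => ⊥,
    inferInstance, ⟨?_, ⟨fun _ _ _ _ _ _ => Subsingleton.elim _ _⟩⟩, ?_,
    fun _ _ _ => Subsingleton.elim _ _⟩
  · rw [DirectSum.isInternal_submodule_iff_iSupIndep_and_iSup_eq_top]
    exact ⟨fun _ => disjoint_bot_left, Subsingleton.elim _ _⟩
  · funext n
    exact finrank_bot F PUnit.{u + 1}

theorem isInternal_prod {N N' : Type*} [AddCommGroup N] [Module F N] [AddCommGroup N'] [Module F N']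
    {𝒩 : ℤ → Submodule F N} {𝒩' : ℤ → Submodule F N'} (h : DirectSum.IsInternal 𝒩)
    (h' : DirectSum.IsInternal 𝒩') : DirectSum.IsInternal fun n => (𝒩 n).prod (𝒩' n) := by
  rw [DirectSum.isInternal_submodule_iff_iSupIndep_and_iSup_eq_top] at h h' ⊢
  constructor
  · intro n
    rw [Submodule.disjoint_def]
    intro x hx hx'
    have h1 : x.1 ∈ ⨆ j, ⨆ (_ : j ≠ n), 𝒩 j := by
      have := Submodule.mem_map_of_mem (f := LinearMap.fst F N N') hx'
      simp only [Submodule.map_iSup] at this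
      have hle : ⨆ j, ⨆ (_ : j ≠ n), ((𝒩 j).prod (𝒩' j)).map (LinearMap.fst F N N') ≤
          ⨆ j, ⨆ (_ : j ≠ n), 𝒩 j := iSup₂_mono fun j _ => ?_
      · exact hle this
      rintro _ ⟨y, hy, rfl⟩
      exact hy.1
    have h2 : x.2 ∈ ⨆ j, ⨆ (_ : j ≠ n), 𝒩' j := by
      have := Submodule.mem_map_of_mem (f := LinearMap.snd F N N') hx'
      simp only [Submodule.map_iSup] at this
      have hle : ⨆ j, ⨆ (_ : j ≠ n), ((𝒩 j).prod (𝒩' j)).map (LinearMap.snd F N N') ≤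
          ⨆ j, ⨆ (_ : j ≠ n), 𝒩' j := iSup₂_mono fun j _ => ?_
      · exact hle this
      rintro _ ⟨y, hy, rfl⟩
      exact hy.2
    exact Prod.ext ((Submodule.disjoint_def.1 (h.1 n)) _ hx.1 h1)
      ((Submodule.disjoint_def.1 (h'.1 n)) _ hx.2 h2)
  · rw [eq_top_iff]
    have h1 : (⊤ : Submodule F N).map (LinearMap.inl F N N') ≤ ⨆ n, (𝒩 n).prod (𝒩' n) := by
      rw [← h.2, Submodule.map_iSup]
      refine iSup_mono fun n => ?_
      rintro _ ⟨y, hy, rfl⟩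
      exact ⟨hy, zero_mem _⟩
    have h2 : (⊤ : Submodule F N').map (LinearMap.inr F N N') ≤ ⨆ n, (𝒩 n).prod (𝒩' n) := by
      rw [← h'.2, Submodule.map_iSup]
      refine iSup_mono fun n => ?_
      rintro _ ⟨y, hy, rfl⟩
      exact ⟨zero_mem _, hy⟩
    rintro ⟨x, y⟩ -
    have := add_mem (h1 ⟨x, trivial, rfl⟩) (h2 ⟨y, trivial, rfl⟩)
    simpa using this

theorem IsRealizable.add (hα : 0 < α) (hβ : 0 < β) (hf : IsRealizable F α β f)
    (hg : IsRealizable F α β g) : IsRealizable F α β (f + g) := by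
  obtain ⟨N, _, _, _, _, 𝒩, hfin, hgr, rfl, hreg⟩ := hf
  obtain ⟨N', _, _, _, _, 𝒩', hfin', hgr', rfl, hreg'⟩ := hg
  refine ⟨N × N', inferInstance, inferInstance, inferInstance, inferInstance,
    fun n => (𝒩 n).prod (𝒩' n), inferInstance,
    ⟨isInternal_prod hgr.isInternal hgr'.isInternal, ⟨fun i j a b ha hb => ?_⟩⟩, ?_, ?_⟩
  · exact ⟨hgr.gradedSMul.smul_mem ha hb.1, hgr'.gradedSMul.smul_mem ha hb.2⟩
  · funext n
    have := hgr.finite_component hα hβ n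
    have := hgr'.finite_component hα hβ n
    simp only [hilbertFunction, Pi.add_apply]
    rw [← Module.finrank_prod]
    exact LinearEquiv.finrank_eq
      { toFun := fun x => (⟨x.1.1, x.2.1⟩, ⟨x.1.2, x.2.2⟩)
        invFun := fun x => ⟨(x.1.1, x.2.1), x.1.2, x.2.2⟩
        map_add' := fun _ _ => rfl
        map_smul' := fun _ _ => rfl
        left_inv := fun _ => rfl
        right_inv := fun _ => rfl }
  · rintro ⟨x, y⟩ ⟨x', y'⟩ hxy
    exact Prod.ext (hreg (congrArg Prod.fst hxy)) (hreg' (congrArg Prod.snd hxy))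

theorem IsRealizable.sum (hα : 0 < α) (hβ : 0 < β) (hf : IsRealizable F α β f) (s : Finset ℤ)
    (c : ℤ → ℕ) : IsRealizable F α β (fun n => ∑ p ∈ s, c p * f (n - p)) := by
  classical
  have hmul : ∀ (c : ℕ) (p : ℤ), IsRealizable F α β (fun n => c * f (n - p)) := by
    intro c p
    induction c with
    | zero => simpa using IsRealizable.zero
    | succ c ih =>
      convert ih.add hα hβ (hf.shift p) using 1
      funext n
      simp [add_mul]
  induction s using Finset.induction_on with
  | empty => simpa using IsRealizable.zero
  | insert p s hp ih =>
    convert (hmul (c p) p).add hα hβ ih using 1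
    funext n
    rw [Finset.sum_insert hp]
    rfl

/-- A polynomial ring onto which `F[X₀, X₁]` maps by a graded homomorphism is a module over
`F[X₀, X₁]`, and `X₀ + X₁` is a nonzerodivisor on it if its image does not vanish. -/
theorem isRealizable_finrank_weightedHomogeneousSubmodule {σ : Type} (w : σ → ℤ)
    (φ : MvPolynomial (Fin 2) F →ₐ[F] MvPolynomial σ F)
    (hφ : ∀ t, φ (X t) ∈ weightedHomogeneousSubmodule F w (weight α β t))
    (hsurj : Function.Surjective φ) (hne : φ (X 0 + X 1) ≠ 0) :
    IsRealizable F α β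
      (fun n => Module.finrank F (weightedHomogeneousSubmodule F w n)) := by
  let inst : Module (MvPolynomial (Fin 2) F) (MvPolynomial σ F) := Module.compHom _ φ.toRingHom
  have hsmul : ∀ (p : MvPolynomial (Fin 2) F) (q : MvPolynomial σ F), inst.smul p q = φ p * q :=
    fun _ _ => rfl
  refine ⟨MvPolynomial σ F, inferInstance, inferInstance, inst, ?_,
    weightedHomogeneousSubmodule F w, ?_, ⟨?_, ⟨?_⟩⟩, rfl, ?_⟩
  · refine @IsScalarTower.mk _ _ _ _ inst.toSMul _ fun a p q => ?_
    change φ (a • p) * q = a • (φ p * q)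
    rw [map_smul, smul_mul_assoc]
  · refine ⟨⟨{1}, ?_⟩⟩
    rw [eq_top_iff]
    rintro q -
    obtain ⟨p, rfl⟩ := hsurj q
    have := Submodule.smul_mem (Submodule.span (MvPolynomial (Fin 2) F)
      (({1} : Finset (MvPolynomial σ F)) : Set (MvPolynomial σ F))) p
      (Submodule.subset_span (by simp : (1 : MvPolynomial σ F) ∈ _))
    have h1 : p • (1 : MvPolynomial σ F) = φ p * 1 := rfl
    rwa [h1, mul_one] at this
  · classical
    let := weightedDecomposition F w
    exact DirectSum.Decomposition.isInternal _
  · intro i j p q hp hq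
    have hφp : IsWeightedHomogeneous w (φ p) i := by
      rw [p.as_sum, map_sum]
      refine IsWeightedHomogeneous.sum _ _ _ fun d hd => ?_
      rw [monomial_eq, map_mul, Finsupp.prod, map_prod, ← algebraMap_eq, AlgHom.commutes,
        algebraMap_eq, ← hp (mem_support_iff.1 hd), Finsupp.weight_apply]
      refine IsWeightedHomogeneous.C_mul (IsWeightedHomogeneous.prod _ _ _ fun t _ => ?_) _
      rw [map_pow]
      exact IsWeightedHomogeneous.pow (hφ t) _
    exact IsWeightedHomogeneous.mul hφp hq
  · intro p q hpq
    exact mul_left_cancel₀ hne hpq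

end Realizable

/-! ### Counting monomials -/

section Counting

variable {F : Type u} [Field F] {σ : Type} {w : σ → ℤ}

theorem finrank_weightedHomogeneousSubmodule (n : ℤ) :
    Module.finrank F (weightedHomogeneousSubmodule F w n) =
      {d : σ →₀ ℕ | Finsupp.weight w d = n}.ncard := by
  rw [weightedHomogeneousSubmodule_eq_finsupp_supported]
  exact Module.finrank_eq_nat_card_basis
    (Module.Basis.ofRepr (AddMonoidAlgebra.supportedEquivFinsupp _))

theorem finite_setOf_weight_eq [Finite σ] (hw : ∀ t, 0 < w t) (n : ℤ) :
    {d : σ →₀ ℕ | Finsupp.weight w d = n}.Finite := by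
  classical
  have := Fintype.ofFinite σ
  refine (Set.finite_Icc 0 (Finsupp.equivFunOnFinite.symm fun _ : σ => n.toNat)).subset ?_
  intro d hd
  refine ⟨zero_le, fun t => ?_⟩
  have h1 : d t * w t ≤ n := by
    rw [← (hd : Finsupp.weight w d = n), Finsupp.weight_apply,
      Finsupp.sum_fintype _ _ (by simp)]
    have := Finset.single_le_sum (f := fun t => d t • w t)
      (fun t _ => smul_nonneg (by simp) (hw t).le) (Finset.mem_univ t)
    simpa using this
  have h2 : (d t : ℤ) ≤ d t * w t := le_mul_of_one_le_right (by positivity) (hw t)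
  simp only [Finsupp.equivFunOnFinite_symm_apply_apply]
  omega

/-- Splitting off the monomials divisible by `X t`. -/
theorem ncard_setOf_weight_eq_add [Finite σ] (hw : ∀ t, 0 < w t) (t : σ) (Q : (σ →₀ ℕ) → Prop)
    (hQ : ∀ d, Q (d + Finsupp.single t 1) ↔ Q d) (n : ℤ) :
    {d : σ →₀ ℕ | Finsupp.weight w d = n ∧ Q d}.ncard =
      {d : σ →₀ ℕ | Finsupp.weight w d = n - w t ∧ Q d}.ncard +
      {d : σ →₀ ℕ | Finsupp.weight w d = n ∧ Q d ∧ d t = 0}.ncard := by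
  have hunion : {d : σ →₀ ℕ | Finsupp.weight w d = n ∧ Q d} =
      (· + Finsupp.single t 1) '' {d : σ →₀ ℕ | Finsupp.weight w d = n - w t ∧ Q d} ∪
      {d : σ →₀ ℕ | Finsupp.weight w d = n ∧ Q d ∧ d t = 0} := by
    ext d
    simp only [Set.mem_ofPred_eq, Set.mem_union, Set.mem_image]
    constructor
    · rintro ⟨h1, h2⟩
      rcases Nat.eq_zero_or_pos (d t) with h0 | h0
      · exact Or.inr ⟨h1, h2, h0⟩
      · have hd : d - Finsupp.single t 1 + Finsupp.single t 1 = d :=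
          tsub_add_cancel_of_le (by simpa [Nat.one_le_iff_ne_zero, Nat.pos_iff_ne_zero] using h0)
        refine Or.inl ⟨d - Finsupp.single t 1, ⟨?_, ?_⟩, hd⟩
        · rw [← h1]
          conv_rhs => rw [← hd, map_add, Finsupp.weight_single, one_smul]
          simp
        · rwa [← hQ, hd]
    · rintro (⟨e, ⟨h1, h2⟩, rfl⟩ | ⟨h1, h2, -⟩)
      · refine ⟨?_, (hQ e).2 h2⟩
        rw [map_add, Finsupp.weight_single, one_smul, h1]
        simp
      · exact ⟨h1, h2⟩
  rw [hunion, Set.ncard_union_eq ?_ ?_ ?_, Set.ncard_image_of_injective _ (add_left_injective _)]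
  · rw [Set.disjoint_left]
    rintro _ ⟨e, -, rfl⟩ ⟨-, -, h0⟩
    simp at h0
  · exact ((finite_setOf_weight_eq hw _).subset fun d hd => hd.1).image _
  · exact (finite_setOf_weight_eq hw _).subset fun d hd => hd.1

theorem ncard_setOf_weight_eq_of_zero (n : ℤ) :
    {d : σ →₀ ℕ | Finsupp.weight w d = n ∧ d = 0}.ncard = if n = 0 then 1 else 0 := by
  have hset : {d : σ →₀ ℕ | Finsupp.weight w d = n ∧ d = 0} = if n = 0 then {0} else ∅ := by
    ext d
    split_ifs with hn
    · simp only [Set.mem_ofPred_eq, Set.mem_singleton_iff, and_iff_right_iff_imp]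
      rintro rfl
      simp [hn]
    · simp only [Set.mem_ofPred_eq, Set.mem_empty_iff_false, iff_false, not_and]
      rintro h rfl
      exact hn (by simpa using h.symm)
  rw [hset]
  split_ifs <;> simp

theorem ncard_setOf_weight_eq_fin_one {c : ℤ} (hc : 0 < c) (n : ℤ) :
    {d : Fin 1 →₀ ℕ | Finsupp.weight (fun _ => c) d = n}.ncard =
      {d : Fin 1 →₀ ℕ | Finsupp.weight (fun _ => c) d = n - c}.ncard +
        if n = 0 then 1 else 0 := by
  have h1 := ncard_setOf_weight_eq_add (w := fun _ => c) (fun _ => hc) (0 : Fin 1)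
    (fun _ => True) (by simp) n
  have h2 := ncard_setOf_weight_eq_of_zero (σ := Fin 1) (w := fun _ => c) n
  have h3 : ∀ d : Fin 1 →₀ ℕ, d = 0 ↔ d 0 = 0 := fun d => by
    rw [Finsupp.ext_iff, Fin.forall_fin_one]; rfl
  simp only [h3] at h2
  simpa only [and_true, true_and, h2] using h1

theorem koszulDiff_ncard_setOf_weight_eq {α β : ℕ} (hα : 0 < α) (hβ : 0 < β) (n : ℤ) :
    koszulDiff α β (fun n => {d : Fin 2 →₀ ℕ | Finsupp.weight (weight α β) d = n}.ncard) n =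
      if n = 0 then 1 else 0 := by
  have hw : ∀ t, 0 < weight α β t := by intro t; fin_cases t <;> simpa [weight]
  have w0 : weight α β 0 = α := rfl
  have w1 : weight α β 1 = β := rfl
  have h1 := ncard_setOf_weight_eq_add hw 0 (fun _ => True) (by simp)
  have h2 := ncard_setOf_weight_eq_add hw 1 (fun d => d 0 = 0) (by simp) n
  have h3 := ncard_setOf_weight_eq_of_zero (w := weight α β) n
  have h4 : ∀ d : Fin 2 →₀ ℕ, d = 0 ↔ d 0 = 0 ∧ d 1 = 0 := fun d => by
    rw [Finsupp.ext_iff, Fin.forall_fin_two]; rfl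
  simp only [h4] at h3
  rw [h3] at h2
  simp only [and_true, true_and, w0, w1] at h1 h2
  have h5 := h1 n
  have h6 := h1 (n - β)
  rw [sub_right_comm] at h6
  simp only [koszulDiff]
  split_ifs at h2 ⊢ <;> omega

end Counting

/-! ### The building blocks -/

section BaseModules

variable (F : Type u) [Field F] {α β : ℕ}

/-- The module `F[X₀]` has the Hilbert series `1 / (1 - t^α)`. -/
theorem exists_isRealizable_left (hα : 0 < α) :
    ∃ f : ℤ → ℕ, IsRealizable F α β f ∧ ∀ n, f n = f (n - α) + if n = 0 then 1 else 0 := by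
  let w : Fin 1 → ℤ := fun _ => α
  refine ⟨_, isRealizable_finrank_weightedHomogeneousSubmodule w (aeval ![X 0, 0]) ?_ ?_ ?_,
    fun n => ?_⟩
  · intro t
    fin_cases t
    · simpa [weight] using isWeightedHomogeneous_X F w 0
    · simp
  · intro q
    refine ⟨rename (Fin.castLE (by omega)) q, ?_⟩
    rw [aeval_rename]
    conv_rhs => rw [← aeval_X_left_apply q]
    congr 2
    funext t
    fin_cases t
    rfl
  · simp
  · simp only [finrank_weightedHomogeneousSubmodule]
    exact ncard_setOf_weight_eq_fin_one (by exact_mod_cast hα) n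

/-- The module `F[X₁]` has the Hilbert series `1 / (1 - t^β)`. -/
theorem exists_isRealizable_right (hβ : 0 < β) :
    ∃ f : ℤ → ℕ, IsRealizable F α β f ∧ ∀ n, f n = f (n - β) + if n = 0 then 1 else 0 := by
  let w : Fin 1 → ℤ := fun _ => β
  refine ⟨_, isRealizable_finrank_weightedHomogeneousSubmodule w (aeval ![0, X 0]) ?_ ?_ ?_,
    fun n => ?_⟩
  · intro t
    fin_cases t
    · simp
    · simpa [weight] using isWeightedHomogeneous_X F w 0
  · intro q
    refine ⟨rename (fun _ => 1) q, ?_⟩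
    rw [aeval_rename]
    conv_rhs => rw [← aeval_X_left_apply q]
    congr 2
    funext t
    fin_cases t
    rfl
  · simp
  · simp only [finrank_weightedHomogeneousSubmodule]
    exact ncard_setOf_weight_eq_fin_one (by exact_mod_cast hβ) n

/-- The module `F[X₀, X₁]` has the Hilbert series `1 / ((1 - t^α)(1 - t^β))`. -/
theorem exists_isRealizable_polynomialRing (hα : 0 < α) (hβ : 0 < β) :
    ∃ f : ℤ → ℕ, IsRealizable F α β f ∧
      ∀ n, koszulDiff α β (fun n => f n) n = if n = 0 then 1 else 0 := by
  refine ⟨_, isRealizable_finrank_weightedHomogeneousSubmodule (weight α β) (AlgHom.id F _)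
    (fun t => isWeightedHomogeneous_X F _ t) Function.surjective_id ?_, fun n => ?_⟩
  · intro h
    have := congrArg (coeff (Finsupp.single 0 1)) h
    simp [coeff_X, Finsupp.single_left_inj] at this
  · simp only [finrank_weightedHomogeneousSubmodule]
    exact koszulDiff_ncard_setOf_weight_eq hα hβ n

end BaseModules

/-! ### Realizing a Hilbert function -/

section Reconstruction

variable {α β : ℕ}

/-- A series that vanishes in low degrees is determined by its product with
`(1 - t^α)(1 - t^β)`. -/
theorem eq_of_koszulDiff_eq (hα : 0 < α) (hβ : 0 < β) {f g : ℤ → ℕ} {B : ℤ}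
    (hf : ∀ n ≤ B, f n = 0) (hg : ∀ n ≤ B, g n = 0)
    (h : ∀ n, koszulDiff α β (fun n => f n) n = koszulDiff α β (fun n => g n) n) : f = g := by
  have key : ∀ k : ℕ, ∀ n ≤ B + k, f n = g n := by
    intro k
    induction k with
    | zero => intro n hn; rw [hf n (by simpa using hn), hg n (by simpa using hn)]
    | succ k ih =>
      intro n hn
      push_cast at hn
      have := h n
      simp only [koszulDiff] at this
      rw [ih (n - α) (by omega), ih (n - β) (by omega), ih (n - α - β) (by omega)] at this
      omega
  funext n
  exact key (n - B).toNat n (by have := Int.self_le_toNat (n - B); omega)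

theorem koszulDiff_sum_shift (s : Finset ℤ) (c f : ℤ → ℕ) (n : ℤ) :
    koszulDiff α β (fun n => ((∑ p ∈ s, c p * f (n - p) : ℕ) : ℤ)) n =
      ∑ p ∈ s, c p * koszulDiff α β (fun n => f n) (n - p) := by
  simp only [koszulDiff, Nat.cast_sum, Nat.cast_mul, ← Finset.sum_sub_distrib,
    ← Finset.sum_add_distrib]
  refine Finset.sum_congr rfl fun p _ => ?_
  simp only [sub_right_comm _ p]
  ring

theorem koszulDiff_add (f g : ℤ → ℕ) (n : ℤ) :
    koszulDiff α β (fun n => ((f + g) n : ℕ)) n =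
      koszulDiff α β (fun n => f n) n + koszulDiff α β (fun n => g n) n := by
  simp only [koszulDiff, Pi.add_apply, Nat.cast_add]; ring

theorem sum_mul_ite_sub_eq (s : Finset ℤ) (c : ℤ → ℕ) (n : ℤ) :
    ∑ p ∈ s, (c p : ℤ) * (if n - p = 0 then 1 else 0) = if n ∈ s then (c n : ℤ) else 0 := by
  simp [sub_eq_zero]

theorem IsRealizable.bddBelow {F : Type u} [Field F] {f : ℤ → ℕ} (h : IsRealizable F α β f) :
    ∃ B : ℤ, ∀ n ≤ B, f n = 0 := by
  obtain ⟨N, _, _, _, _, 𝒩, _, hgr, rfl, -⟩ := h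
  obtain ⟨B, hB⟩ := hgr.component_bddBelow
  exact ⟨B, fun n hn => by rw [hilbertFunction, hB n hn, finrank_bot]⟩

/-- A series with the denominator `(1 - t^α)(1 - t^β)` whose coefficients split into a part
monotone along `α` and a part monotone along `β` is the Hilbert series of a finite direct sum of
shifted copies of `F[X₀]`, `F[X₁]` and `F[X₀, X₁]`. The increments of the two parts give the
numbers of generators; the generators `F[X₀]` in the last `β` degrees before the numerator has
ended and the generators `F[X₁]` in the last `α` degrees are replaced with free ones. -/
theorem isRealizable_of_add (F : Type u) [Field F] (hα : 0 < α) (hβ : 0 < β) {h u v : ℤ → ℕ}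
    {B C : ℤ} (hB : ∀ n ≤ B, h n = 0) (hC : ∀ n ≥ C, koszulDiff α β (fun n => h n) n = 0)
    (huv : ∀ n, h n = u n + v n) (hu : ∀ n, u n ≤ u (n + α)) (hv : ∀ n, v n ≤ v (n + β)) :
    IsRealizable F α β h := by
  obtain ⟨f₀, hf₀, hrec₀⟩ := exists_isRealizable_left F (α := α) (β := β) hα
  obtain ⟨f₁, hf₁, hrec₁⟩ := exists_isRealizable_right F (α := α) (β := β) hβ
  obtain ⟨f, hf, hrec⟩ := exists_isRealizable_polynomialRing F hα hβ
  set N := max C (B + α + β) with hN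
  have hNC : C ≤ N := le_max_left _ _
  have hNB : B + α + β ≤ N := le_max_right _ _
  let a : ℤ → ℕ := fun n => u n - u (n - α)
  let b : ℤ → ℕ := fun n => v n - v (n - β)
  have ha : ∀ n, (a n : ℤ) = u n - u (n - α) := by
    intro n
    have := hu (n - α)
    rw [sub_add_cancel] at this
    simp only [a]
    omega
  have hb : ∀ n, (b n : ℤ) = v n - v (n - β) := by
    intro n
    have := hv (n - β)
    rw [sub_add_cancel] at this
    simp only [b]
    omega
  have ha0 : ∀ n ≤ B, a n = 0 := by
    intro n hn
    have := huv n
    have := hB n hn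
    simp only [a]
    omega
  have hb0 : ∀ n ≤ B, b n = 0 := by
    intro n hn
    have := huv n
    have := hB n hn
    simp only [b]
    omega
  have hreal := ((hf₀.sum hα hβ (Finset.Ico B (N - β)) a).add hα hβ
    (hf.sum hα hβ (Finset.Ico (N - β) N) a)).add hα hβ
    ((hf₁.sum hα hβ (Finset.Ico B (N - α)) b).add hα hβ
    (hf.sum hα hβ (Finset.Ico (N - α) N) b))
  obtain ⟨B', hB'⟩ := hreal.bddBelow
  convert hreal using 1
  refine eq_of_koszulDiff_eq hα hβ (B := min B B')
    (fun n hn => hB n (hn.trans (min_le_left _ _)))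
    (fun n hn => hB' n (hn.trans (min_le_right _ _))) fun n => ?_
  have hd₀ : ∀ n, koszulDiff α β (fun n => f₀ n) n =
      (if n = 0 then 1 else 0) - if n - β = 0 then 1 else 0 := by
    intro n
    have h1 := hrec₀ n
    have h2 := hrec₀ (n - β)
    rw [sub_right_comm] at h2
    simp only [koszulDiff]
    split_ifs at * <;> omega
  have hd₁ : ∀ n, koszulDiff α β (fun n => f₁ n) n =
      (if n = 0 then 1 else 0) - if n - α = 0 then 1 else 0 := by
    intro n
    have h1 := hrec₁ n
    have h2 := hrec₁ (n - α)
    simp only [koszulDiff]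
    split_ifs at * <;> omega
  rw [koszulDiff_add, koszulDiff_add, koszulDiff_add]
  simp only [koszulDiff_sum_shift, hd₀, hd₁, hrec, mul_sub, Finset.sum_sub_distrib,
    sub_right_comm n _ (α : ℤ), sub_right_comm n _ (β : ℤ), sum_mul_ite_sub_eq, Finset.mem_Ico]
  have hh : koszulDiff α β (fun n => h n) n = a n - a (n - β) + (b n - b (n - α)) := by
    simp only [koszulDiff, huv, ha, hb, sub_right_comm n (β : ℤ) α]
    push_cast
    ring
  have h1 := ha0 n
  have h2 := ha0 (n - β)
  have h3 := hb0 n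
  have h4 := hb0 (n - α)
  have h5 := hC n
  rw [hh] at h5 ⊢
  split_ifs <;> omega

end Reconstruction

end HilbertDepth

theorem theorem3p13 {F : Type u} [Field F] (α β : ℕ) (hα : 0 < α) (hβ : 0 < β)
    (hαβ : Nat.Coprime α β) {M : Type v} [AddCommGroup M] [Module F M]
    [Module (MvPolynomial (Fin 2) F) M] [IsScalarTower F (MvPolynomial (Fin 2) F) M]
    [Module.Finite (MvPolynomial (Fin 2) F) M] (ℳ : ℤ → Submodule F M)
    (hℳ : HilbertDepth.IsGradedModule α β ℳ) :
    0 < HilbertDepth.hilbertDepth α β ℳ ↔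
      HilbertDepth.StarCondition α β (HilbertDepth.hilbertFunction ℳ) := by
  constructor
  · intro hpos
    obtain ⟨_, ⟨N, _, _, _, _, 𝒩, _, hgr, hf, rfl⟩, hd⟩ := lt_sSup_iff.1 hpos
    rw [← hf]
    exact hgr.starCondition_of_depth_pos hα hβ hd
  · intro hstar
    obtain ⟨B, hB⟩ := hℳ.component_bddBelow
    have hB' : ∀ n ≤ B, HilbertDepth.hilbertFunction ℳ n = 0 := fun n hn => by
      rw [HilbertDepth.hilbertFunction, hB n hn, finrank_bot]
    obtain ⟨C, hC⟩ := hℳ.koszulDiff_eventually_zero hα hβ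
    obtain ⟨u, v, huv, hu, hv⟩ :=
      HilbertDepth.exists_add_of_starCondition hαβ hα hβ hstar hB'
    exact (HilbertDepth.isRealizable_of_add F hα hβ hB' hC huv hu hv).hilbertDepth_pos
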